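/- Let $d\in\mathbf N$, $s>1$, $q\in[1,\infty]$, let $X\subseteq\mathbf R^d$ be open, and for $k>0$ let $\omega_k(\xi)=e^{k|\xi|^{1/s}}$, $\xi\in\mathbf R^d$. Let $\mathcal E^{(s)}(\mathbf R^d)$ be the space of all $g\in C^\infty(\mathbf R^d)$ such that $$\sup_{\beta\in\mathbf N^d}\ \sup_{x\in K}\frac{A^{|\beta|}}{(\beta!)^s}|\partial^\beta g(x)|<\infty$$ for every compact $K\subset\mathbf R^d$ and every $A>0$; let $\mathcal D^{(s)}(X)$ be the subspace of those functions whose support is a compact subset of $X$; and let $(\mathcal D^{(s)})'(\mathbf R^d)$ (ultradistributions of Beurling type) and $(\mathcal E^{(s)})'(\mathbf R^d)$ be the spaces of continuous linear functionals on $\mathcal D^{(s)}(\mathbf R^d)$ (with its usual inductive limit topology) and on $\mathcal E^{(s)}(\mathbf R^d)$ (with the topology of the above seminorms). For $f\in(\mathcal D^{(s)})'(\mathbf R^d)$ and $\varphi\in\mathcal D^{(s)}(X)$, the product $\varphi f\in(\mathcal E^{(s)})'(\mathbf R^d)$ is given by $\langle\varphi f,g\rangle=\langle f,\varphi g\rangle$,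 and its Fourier transform is the function $\widehat{\varphi f}(\xi)=(2\pi)^{-d/2}\langle f,\varphi\, e^{-i\langle\cdot,\xi\rangle}\rangle$. An open cone is an open set $\Gamma\subseteq\mathbf R^d\setminus 0$ with $t\xi\in\Gamma$ for all $\xi\in\Gamma$ and $t>0$. For $f\in(\mathcal D^{(s)})'(\mathbf R^d)$ and a weight $\omega$, the wave-front set $\operatorname{WF}_{\mathscr FL^q_{(\omega)}}(f)$ is the set of all $(x_0,\xi_0)\in X\times(\mathbf R^d\setminus 0)$ such that, for every $\varphi\in\mathcal D^{(s)}(X)$ with $\varphi(x_0)\ne0$ and every open cone $\Gamma$ containing $\xi_0$, $$\|\widehat{\varphi f}\,\omega\|_{L^q(\Gamma)}=\infty .$$ The $\{s\}$-wave-front set $\operatorname{WF}_s(f)$ is the set of all $(x_0,\xi_0)\in X\times(\mathbf R^d\setminus 0)$ for which there do not exist $\varphi\in\mathcal D^{(s)}(X)$ equal to $1$ in a neighbourhood of $x_0$, an open cone $\Gamma$ containing $\xi_0$, and constants $k,C>0$ with $$|\widehat{\varphi f}(\xi)|\le Ce^{-k|\xi|^{1/s}}\qquad\text{for all }\xi\in\Gamma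 .$$ Then, for every $f\in(\mathcal D^{(s)})'(\mathbf R^d)$, $$\bigcap_{k>0}\operatorname{WF}_{\mathscr FL^q_{(\omega_k)}}(f)=\operatorname{WF}_s(f).$$ -/

import Mathlib

open scoped ENNReal NNReal Topology ContDiff

noncomputable section

namespace UltraWF

/-- Euclidean space `ℝᵈ`. -/
abbrev Rd (d : ℕ) : Type := EuclideanSpace ℝ (Fin d)

/-- The Gevrey norm `sup_n sup_{x ∈ K} Aⁿ / (n!)ˢ * ‖φ⁽ⁿ⁾(x)‖`, where `‖φ⁽ⁿ⁾(x)‖` is the norm of the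
`n`-th total derivative. Since `|β|! ≤ d^{|β|} β!` and the norm of the `n`-th total derivative is at
most `dⁿ` times the largest partial derivative of order `n`, the family of these norms over `A > 0`
is equivalent to the family `sup_β sup_{x ∈ K} A^{|β|} / (β!)ˢ * |∂^β φ(x)|`
(up to rescaling `A` by a constant that depends only on `d` and `s`). -/
def ultraNorm {d : ℕ} (s A : ℝ) (K : Set (Rd d)) (φ : Rd d → ℂ) : ℝ≥0∞ :=
  ⨆ n : ℕ, ⨆ x ∈ K, ENNReal.ofReal (A ^ n / (n.factorial : ℝ) ^ s) * ‖iteratedFDeriv ℝ n φ x‖ₑ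

theorem le_ultraNorm {d : ℕ} (s A : ℝ) {K : Set (Rd d)} (φ : Rd d → ℂ) (n : ℕ) {x : Rd d}
    (hx : x ∈ K) :
    ENNReal.ofReal (A ^ n / (n.factorial : ℝ) ^ s) * ‖iteratedFDeriv ℝ n φ x‖ₑ ≤ ultraNorm s A K φ :=
  le_iSup_of_le n (le_iSup₂_of_le x hx le_rfl)

theorem ultraNorm_zero {d : ℕ} (s A : ℝ) (K : Set (Rd d)) :
    ultraNorm s A K (0 : Rd d → ℂ) = 0 := by
  simp only [ultraNorm, ENNReal.iSup_eq_zero]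
  intro n x _
  have h : iteratedFDeriv ℝ n (0 : Rd d → ℂ) x = 0 := by
    simp
  rw [h]
  simp

theorem ultraNorm_add_le {d : ℕ} (s A : ℝ) (K : Set (Rd d)) {φ ψ : Rd d → ℂ}
    (hφ : ContDiff ℝ ∞ φ) (hψ : ContDiff ℝ ∞ ψ) :
    ultraNorm s A K (φ + ψ) ≤ ultraNorm s A K φ + ultraNorm s A K ψ := by
  refine iSup_le fun n => iSup₂_le fun x hx => ?_
  rw [iteratedFDeriv_add_apply (hφ.contDiffAt.of_le (by exact_mod_cast le_top))
    (hψ.contDiffAt.of_le (by exact_mod_cast le_top))]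
  refine (mul_le_mul_right (enorm_add_le _ _) _).trans ?_
  rw [mul_add]
  exact add_le_add (le_ultraNorm s A φ n hx) (le_ultraNorm s A ψ n hx)

theorem ultraNorm_smul_le {d : ℕ} (s A : ℝ) (K : Set (Rd d)) {φ : Rd d → ℂ}
    (hφ : ContDiff ℝ ∞ φ) (c : ℂ) :
    ultraNorm s A K (c • φ) ≤ ‖c‖ₑ * ultraNorm s A K φ := by
  refine iSup_le fun n => iSup₂_le fun x hx => ?_
  rw [iteratedFDeriv_const_smul_apply (hφ.contDiffAt.of_le (by exact_mod_cast le_top)),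
    enorm_smul, mul_left_comm]
  exact mul_le_mul_right (le_ultraNorm s A φ n hx) _

/-- `‖φ g‖_{s,A,K} ≤ ‖φ‖_{s,2A,K} ‖g‖_{s,2A,K}`. -/
theorem ultraNorm_mul_le {d : ℕ} {s A : ℝ} (hs : 1 < s) (hA : 0 < A) (K : Set (Rd d))
    {φ g : Rd d → ℂ} (hφ : ContDiff ℝ ∞ φ) (hg : ContDiff ℝ ∞ g) :
    ultraNorm s A K (φ * g) ≤ ultraNorm s (2 * A) K φ * ultraNorm s (2 * A) K g := by
  refine iSup_le fun n => iSup₂_le fun x hx => ?_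
  have hL := norm_iteratedFDeriv_mul_le (𝕜 := ℝ) (N := ∞) hφ hg x (n := n)
    (by exact_mod_cast le_top)
  -- the coefficient of each term of the Leibniz formula
  have hcoef : ∀ i ∈ Finset.range (n + 1),
      A ^ n / (n.factorial : ℝ) ^ s * (n.choose i : ℝ) ≤
        (2⁻¹ : ℝ) ^ n * ((2 * A) ^ i / (i.factorial : ℝ) ^ s * ((2 * A) ^ (n - i) / ((n - i).factorial : ℝ) ^ s)) := by
    intro i hi
    have hin : i ≤ n := Nat.lt_succ_iff.mp (Finset.mem_range.mp hi)
    have hfac : (n.choose i : ℝ) * (i.factorial : ℝ) * ((n - i).factorial : ℝ) = (n.factorial : ℝ) := by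
      exact_mod_cast Nat.choose_mul_factorial_mul_factorial hin
    have hc1 : (1 : ℝ) ≤ (n.choose i : ℝ) := by exact_mod_cast Nat.choose_pos hin
    have hp1 : (0 : ℝ) < (i.factorial : ℝ) ^ s := Real.rpow_pos_of_pos (by positivity) s
    have hp2 : (0 : ℝ) < ((n - i).factorial : ℝ) ^ s := Real.rpow_pos_of_pos (by positivity) s
    have hp3 : (0 : ℝ) < (n.choose i : ℝ) ^ s := Real.rpow_pos_of_pos (by linarith) s
    have hcs : (n.choose i : ℝ) ≤ (n.choose i : ℝ) ^ s := Real.self_le_rpow_of_one_le hc1 hs.le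
    rw [← hfac, Real.mul_rpow (by positivity) (by positivity),
      Real.mul_rpow (by positivity) (by positivity)]
    have hpow : (2⁻¹ : ℝ) ^ n * ((2 * A) ^ i * (2 * A) ^ (n - i)) = A ^ n := by
      rw [← pow_add, Nat.add_sub_cancel' hin, ← mul_pow]
      congr 1
      ring
    have hr : (2⁻¹ : ℝ) ^ n * ((2 * A) ^ i / (i.factorial : ℝ) ^ s *
        ((2 * A) ^ (n - i) / ((n - i).factorial : ℝ) ^ s)) = A ^ n / ((i.factorial : ℝ) ^ s * ((n - i).factorial : ℝ) ^ s) := by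
      rw [← hpow]
      field_simp
    rw [hr, div_mul_eq_mul_div, div_le_div_iff₀ (by positivity) (by positivity)]
    have : 0 ≤ A ^ n * ((i.factorial : ℝ) ^ s * ((n - i).factorial : ℝ) ^ s) := by positivity
    nlinarith [mul_le_mul_of_nonneg_left hcs this]
  by_cases htop : ultraNorm s (2 * A) K φ * ultraNorm s (2 * A) K g = ⊤
  · rw [htop]
    exact le_top
  have hterm : ∀ i ∈ Finset.range (n + 1),
      A ^ n / (n.factorial : ℝ) ^ s *
        ((n.choose i : ℝ) * ‖iteratedFDeriv ℝ i φ x‖ * ‖iteratedFDeriv ℝ (n - i) g x‖) ≤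
        (2⁻¹ : ℝ) ^ n * (ultraNorm s (2 * A) K φ * ultraNorm s (2 * A) K g).toReal := by
    intro i hi
    have h1 := mul_le_mul' (le_ultraNorm s (2 * A) φ i hx) (le_ultraNorm s (2 * A) g (n - i) hx)
    have h2 := ENNReal.toReal_mono htop h1
    simp only [ENNReal.toReal_mul, toReal_enorm] at h2
    rw [ENNReal.toReal_ofReal (by positivity), ENNReal.toReal_ofReal (by positivity),
      ← ENNReal.toReal_mul] at h2
    calc _ = (A ^ n / (n.factorial : ℝ) ^ s * (n.choose i : ℝ)) *
          (‖iteratedFDeriv ℝ i φ x‖ * ‖iteratedFDeriv ℝ (n - i) g x‖) := by ring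
      _ ≤ _ := mul_le_mul_of_nonneg_right (hcoef i hi) (by positivity)
      _ = (2⁻¹ : ℝ) ^ n * ((2 * A) ^ i / (i.factorial : ℝ) ^ s * ‖iteratedFDeriv ℝ i φ x‖ *
          ((2 * A) ^ (n - i) / ((n - i).factorial : ℝ) ^ s * ‖iteratedFDeriv ℝ (n - i) g x‖)) := by ring
      _ ≤ _ := mul_le_mul_of_nonneg_left h2 (by positivity)
  have hsum : A ^ n / (n.factorial : ℝ) ^ s * ‖iteratedFDeriv ℝ n (φ * g) x‖ ≤
      (ultraNorm s (2 * A) K φ * ultraNorm s (2 * A) K g).toReal := by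
    have hc : (0 : ℝ) ≤ A ^ n / (n.factorial : ℝ) ^ s := by positivity
    refine (mul_le_mul_of_nonneg_left hL hc).trans ?_
    rw [Finset.mul_sum]
    refine (Finset.sum_le_sum hterm).trans ?_
    rw [Finset.sum_const, Finset.card_range, nsmul_eq_mul, ← mul_assoc]
    refine mul_le_of_le_one_left ENNReal.toReal_nonneg ?_
    have h2 : ((n + 1 : ℕ) : ℝ) ≤ 2 ^ n := by exact_mod_cast Nat.lt_two_pow_self
    rw [inv_pow, ← div_eq_mul_inv, div_le_one (by positivity)]
    exact h2
  rw [← ofReal_norm, ← ENNReal.ofReal_mul (by positivity)]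
  exact ENNReal.ofReal_le_of_le_toReal hsum

/-- The space `ℰ^{(s)}(ℝᵈ)`: smooth functions all of whose Gevrey norms (for every compact `K` and
every `A > 0`) are finite. -/
def EBeurling (d : ℕ) (s : ℝ) : Submodule ℂ (Rd d → ℂ) where
  carrier := {g | ContDiff ℝ ∞ g ∧
    ∀ K : Set (Rd d), IsCompact K → ∀ A : ℝ, 0 < A → ultraNorm s A K g < ⊤}
  zero_mem' := ⟨contDiff_const, fun K _ A _ => by
    rw [ultraNorm_zero]
    exact ENNReal.zero_lt_top⟩
  add_mem' := fun {φ ψ} hφ hψ => ⟨hφ.1.add hψ.1, fun K hK A hA =>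
    (ultraNorm_add_le s A K hφ.1 hψ.1).trans_lt
      (ENNReal.add_lt_top.mpr ⟨hφ.2 K hK A hA, hψ.2 K hK A hA⟩)⟩
  smul_mem' := fun c φ hφ => ⟨hφ.1.const_smul c, fun K hK A hA =>
    (ultraNorm_smul_le s A K hφ.1 c).trans_lt (ENNReal.mul_lt_top enorm_lt_top (hφ.2 K hK A hA))⟩

/-- The test function space `𝒟^{(s)}(X)`: the elements of `ℰ^{(s)}(ℝᵈ)` whose support is a compact
subset of `X` (functions on `X` with compact support are extended by zero). -/
def DBeurling {d : ℕ} (s : ℝ) (X : Set (Rd d)) : Submodule ℂ (Rd d → ℂ) where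
  carrier := {φ | φ ∈ EBeurling d s ∧ HasCompactSupport φ ∧ tsupport φ ⊆ X}
  zero_mem' := ⟨Submodule.zero_mem _, HasCompactSupport.zero, by simp [tsupport]⟩
  add_mem' := fun hφ hψ => ⟨Submodule.add_mem _ hφ.1 hψ.1, hφ.2.1.add hψ.2.1,
    (tsupport_add _ _).trans (Set.union_subset hφ.2.2 hψ.2.2)⟩
  smul_mem' := fun c φ hφ => ⟨Submodule.smul_mem _ c hφ.1, hφ.2.1.smul_left (f := fun _ => c),
    (tsupport_smul_subset_right (fun _ => c) φ).trans hφ.2.2⟩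

theorem mul_mem_EBeurling {d : ℕ} {s : ℝ} (hs : 1 < s) {φ g : Rd d → ℂ}
    (hφ : φ ∈ EBeurling d s) (hg : g ∈ EBeurling d s) : φ * g ∈ EBeurling d s :=
  ⟨hφ.1.mul hg.1, fun K hK A hA => (ultraNorm_mul_le hs hA K hφ.1 hg.1).trans_lt
    (ENNReal.mul_lt_top (hφ.2 K hK _ (by positivity)) (hg.2 K hK _ (by positivity)))⟩

theorem mul_mem_DBeurling {d : ℕ} {s : ℝ} (hs : 1 < s) {X : Set (Rd d)} {φ g : Rd d → ℂ}
    (hφ : φ ∈ DBeurling s X) (hg : g ∈ EBeurling d s) :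
    φ * g ∈ DBeurling s (Set.univ : Set (Rd d)) :=
  ⟨mul_mem_EBeurling hs hφ.1 hg, hφ.2.1.mul_right, Set.subset_univ _⟩

/-- The space `(𝒟^{(s)})'(ℝᵈ)` of ultradistributions of Beurling type: the linear functionals on
`𝒟^{(s)}(ℝᵈ)` that are continuous for its inductive limit topology, that is, whose restriction to
the test functions supported in any fixed compact set `K` is bounded by a multiple of one of the
norms which define the topology there (these norms increase with `A`). -/
structure Ultradistribution (d : ℕ) (s : ℝ) where
  toLinearMap : DBeurling s (Set.univ : Set (Rd d)) →ₗ[ℂ] ℂ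
  continuous' : ∀ K : Set (Rd d), IsCompact K → ∃ A : ℝ, 0 < A ∧ ∃ C : ℝ≥0,
    ∀ φ : DBeurling s (Set.univ : Set (Rd d)), tsupport (φ : Rd d → ℂ) ⊆ K →
      ‖toLinearMap φ‖ₑ ≤ C * ultraNorm s A K φ

/-- The space `(ℰ^{(s)})'(ℝᵈ)` of compactly supported ultradistributions of Beurling type: the
continuous linear functionals on `ℰ^{(s)}(ℝᵈ)`. -/
structure CompactUltradistribution (d : ℕ) (s : ℝ) where
  toLinearMap : EBeurling d s →ₗ[ℂ] ℂ
  continuous' : ∃ K : Set (Rd d), IsCompact K ∧ ∃ A : ℝ, 0 < A ∧ ∃ C : ℝ≥0,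
    ∀ g : EBeurling d s, ‖toLinearMap g‖ₑ ≤ C * ultraNorm s A K g

/-- The product `φ f ∈ (ℰ^{(s)})'(ℝᵈ)` of a test function `φ ∈ 𝒟^{(s)}(X)` and an ultradistribution
`f ∈ (𝒟^{(s)})'(ℝᵈ)`, given by `⟨φ f, g⟩ = ⟨f, φ g⟩`. -/
def Ultradistribution.localize {d : ℕ} {s : ℝ} (hs : 1 < s) {X : Set (Rd d)}
    (f : Ultradistribution d s) (φ : DBeurling s X) : CompactUltradistribution d s where
  toLinearMap :=
    { toFun := fun g => f.toLinearMap ⟨(φ : Rd d → ℂ) * g, mul_mem_DBeurling hs φ.2 g.2⟩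
      map_add' := fun g h => by
        rw [← map_add]
        congr 1
        exact Subtype.ext (mul_add _ _ _)
      map_smul' := fun c g => by
        rw [RingHom.id_apply, ← map_smul]
        congr 1
        exact Subtype.ext (mul_smul_comm c _ _) }
  continuous' := by
    obtain ⟨A, hA, C, hC⟩ := f.continuous' (tsupport (φ : Rd d → ℂ)) φ.2.2.1
    have hfin : ultraNorm s (2 * A) (tsupport (φ : Rd d → ℂ)) φ ≠ ⊤ :=
      (φ.2.1.2 _ φ.2.2.1 (2 * A) (by positivity)).ne
    refine ⟨tsupport (φ : Rd d → ℂ), φ.2.2.1, 2 * A, by positivity,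
      C * (ultraNorm s (2 * A) (tsupport (φ : Rd d → ℂ)) φ).toNNReal, fun g => ?_⟩
    refine (hC ⟨(φ : Rd d → ℂ) * g, mul_mem_DBeurling hs φ.2 g.2⟩
      (tsupport_mul_subset_left (f := (φ : Rd d → ℂ)) (g := (g : Rd d → ℂ)))).trans ?_
    rw [ENNReal.coe_mul, ENNReal.coe_toNNReal hfin, mul_assoc]
    exact mul_le_mul_right (ultraNorm_mul_le hs hA _ φ.2.1.1 g.2.1) _

/-- The exponential `x ↦ e^{-i ⟨x, ξ⟩}`. -/
def expFun {d : ℕ} (ξ : Rd d) : Rd d → ℂ :=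
  fun x => Complex.exp (-(Complex.I * ((inner ℝ x ξ : ℝ) : ℂ)))

theorem contDiff_expFun {d : ℕ} (ξ : Rd d) : ContDiff ℝ ∞ (expFun ξ) := by
  unfold expFun
  refine ContDiff.cexp (ContDiff.neg (contDiff_const.mul ?_))
  exact Complex.ofRealCLM.contDiff.comp (contDiff_id.inner ℝ contDiff_const)

theorem norm_iteratedFDeriv_expFun_le {d : ℕ} (ξ : Rd d) (n : ℕ) (x : Rd d) :
    ‖iteratedFDeriv ℝ n (expFun ξ) x‖ ≤ ‖ξ‖ ^ n := by
  have hder : ∀ t : ℝ, HasDerivAt (fun t : ℝ => Complex.exp (-(Complex.I * (t : ℂ))))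
      (-Complex.I * Complex.exp (-(Complex.I * (t : ℂ)))) t := by
    intro t
    have h1 : HasDerivAt (fun t : ℝ => -(Complex.I * (t : ℂ))) (-(Complex.I * 1)) t :=
      ((Complex.ofRealCLM.hasDerivAt (x := t)).const_mul Complex.I).neg
    convert h1.cexp using 1
    ring
  have hit : ∀ m : ℕ, iteratedDeriv m (fun t : ℝ => Complex.exp (-(Complex.I * (t : ℂ)))) =
      fun t : ℝ => (-Complex.I) ^ m * Complex.exp (-(Complex.I * (t : ℂ))) := by
    intro m
    induction m with
    | zero => simp
    | succ m ih =>
      rw [iteratedDeriv_succ, ih]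
      funext t
      rw [((hder t).const_mul _).deriv]
      ring
  have hsm : ContDiff ℝ ∞ (fun t : ℝ => Complex.exp (-(Complex.I * (t : ℂ)))) :=
    ContDiff.cexp (ContDiff.neg (contDiff_const.mul Complex.ofRealCLM.contDiff))
  have hcomp : expFun ξ = (fun t : ℝ => Complex.exp (-(Complex.I * (t : ℂ)))) ∘ (innerSL ℝ ξ) := by
    funext y
    simp [expFun, real_inner_comm]
  rw [hcomp, ContinuousLinearMap.iteratedFDeriv_comp_right _ hsm _ (by exact_mod_cast le_top)]
  refine (ContinuousMultilinearMap.norm_compContinuousLinearMap_le _ _).trans ?_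
  rw [norm_iteratedFDeriv_eq_norm_iteratedDeriv, hit]
  have hexp : ‖Complex.exp (-(Complex.I * ((innerSL ℝ ξ x : ℝ) : ℂ)))‖ = 1 := by
    rw [Complex.norm_exp]
    simp
  simp only [norm_mul, norm_pow, norm_neg, Complex.norm_I, one_pow, one_mul, hexp,
    innerSL_apply_norm, Finset.prod_const, Finset.card_univ, Fintype.card_fin]
  exact le_rfl

theorem expFun_mem {d : ℕ} {s : ℝ} (hs : 1 < s) (ξ : Rd d) : expFun ξ ∈ EBeurling d s := by
  refine ⟨contDiff_expFun ξ, fun K _ A hA => ?_⟩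
  refine lt_of_le_of_lt (b := ENNReal.ofReal (Real.exp (A * ‖ξ‖))) ?_ ENNReal.ofReal_lt_top
  refine iSup_le fun n => iSup₂_le fun x _ => ?_
  rw [← ofReal_norm, ← ENNReal.ofReal_mul (by positivity)]
  refine ENNReal.ofReal_le_ofReal ?_
  have h1 : (1 : ℝ) ≤ (n.factorial : ℝ) := by exact_mod_cast Nat.one_le_iff_ne_zero.mpr (Nat.factorial_ne_zero n)
  have h2 : (n.factorial : ℝ) ≤ (n.factorial : ℝ) ^ s := Real.self_le_rpow_of_one_le h1 hs.le
  calc A ^ n / (n.factorial : ℝ) ^ s * ‖iteratedFDeriv ℝ n (expFun ξ) x‖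
      ≤ A ^ n / (n.factorial : ℝ) * ‖ξ‖ ^ n := by
        refine mul_le_mul ?_ (norm_iteratedFDeriv_expFun_le ξ n x) (norm_nonneg _) (by positivity)
        exact div_le_div_of_nonneg_left (by positivity) (by positivity) h2
    _ = (A * ‖ξ‖) ^ n / (n.factorial : ℝ) := by
        rw [mul_pow]
        ring
    _ ≤ Real.exp (A * ‖ξ‖) := Real.pow_div_factorial_le_exp _ (by positivity) n

/-- The Fourier transform of a compactly supported ultradistribution, the function
`û(ξ) = (2π)^{-d/2} ⟨u, e^{-i ⟨·, ξ⟩}⟩`. -/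
def fourier {d : ℕ} {s : ℝ} (hs : 1 < s) (u : CompactUltradistribution d s) (ξ : Rd d) : ℂ :=
  (((2 * Real.pi) ^ (-(d : ℝ) / 2) : ℝ) : ℂ) * u.toLinearMap ⟨expFun ξ, expFun_mem hs ξ⟩

/-- Open cones in `ℝᵈ ∖ 0`. -/
def IsOpenCone {d : ℕ} (Γ : Set (Rd d)) : Prop :=
  IsOpen Γ ∧ (0 : Rd d) ∉ Γ ∧ ∀ ξ ∈ Γ, ∀ t : ℝ, 0 < t → t • ξ ∈ Γ

/-- The seminorm `|u|_{ℱL^q_{(w)}(Γ)} = ‖û w‖_{L^q(Γ)}`, with values in `[0, ∞]`. -/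
def coneSeminorm {d : ℕ} {s : ℝ} (hs : 1 < s) (q : ℝ≥0∞) (w : Rd d → ℝ) (Γ : Set (Rd d))
    (u : CompactUltradistribution d s) : ℝ≥0∞ :=
  MeasureTheory.eLpNorm (fun ξ => fourier hs u ξ * (w ξ : ℂ)) q
    (MeasureTheory.volume.restrict Γ)

/-- `Θ_ℬ(u)` for `ℬ = ℱL^q_{(w)}`: the directions `ξ ≠ 0` with an open conical neighbourhood on
which the seminorm of `u` is finite. -/
def Theta {d : ℕ} {s : ℝ} (hs : 1 < s) (q : ℝ≥0∞) (w : Rd d → ℝ)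
    (u : CompactUltradistribution d s) : Set (Rd d) :=
  {ξ | ξ ≠ 0 ∧ ∃ Γ : Set (Rd d), IsOpenCone Γ ∧ ξ ∈ Γ ∧ coneSeminorm hs q w Γ u < ⊤}

/-- `Σ_ℬ(u)`: the complement of `Θ_ℬ(u)` in `ℝᵈ ∖ 0`. -/
def Sigma {d : ℕ} {s : ℝ} (hs : 1 < s) (q : ℝ≥0∞) (w : Rd d → ℝ)
    (u : CompactUltradistribution d s) : Set (Rd d) :=
  {ξ | ξ ≠ 0 ∧ ξ ∉ Theta hs q w u}

/-- The wave-front set `WF_{ℱL^q_{(w)}}(f) ⊆ X × (ℝᵈ ∖ 0)` of `f ∈ (𝒟^{(s)})'(ℝᵈ)`. -/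
def WFFourierLebesgue {d : ℕ} {s : ℝ} (hs : 1 < s) (X : Set (Rd d)) (q : ℝ≥0∞) (w : Rd d → ℝ)
    (f : Ultradistribution d s) : Set (Rd d × Rd d) :=
  {p | p.1 ∈ X ∧ p.2 ≠ 0 ∧
    ∀ φ : DBeurling s X, (φ : Rd d → ℂ) p.1 ≠ 0 → p.2 ∈ Sigma hs q w (f.localize hs φ)}

/-- `f` is `{s}`-micro-regular at `(x₀, ξ₀)`: some localization of `f` by a cut-off in `𝒟^{(s)}(X)`
that equals `1` near `x₀` has a Fourier transform which is `O(e^{-k|ξ|^{1/s}})` for some `k > 0` in an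
open cone around `ξ₀`. -/
def MicroRegular {d : ℕ} {s : ℝ} (hs : 1 < s) (X : Set (Rd d)) (f : Ultradistribution d s)
    (x₀ ξ₀ : Rd d) : Prop :=
  ∃ φ : DBeurling s X, (∀ᶠ x in 𝓝 x₀, (φ : Rd d → ℂ) x = 1) ∧
    ∃ Γ : Set (Rd d), IsOpenCone Γ ∧ ξ₀ ∈ Γ ∧ ∃ k : ℝ, 0 < k ∧ ∃ C : ℝ, 0 < C ∧
      ∀ ξ ∈ Γ, ‖fourier hs (f.localize hs φ) ξ‖ ≤ C * Real.exp (-k * ‖ξ‖ ^ (1 / s))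

/-- The `{s}`-wave-front set `WF_s(f) ⊆ X × (ℝᵈ ∖ 0)`. -/
def WFs {d : ℕ} {s : ℝ} (hs : 1 < s) (X : Set (Rd d)) (f : Ultradistribution d s) :
    Set (Rd d × Rd d) :=
  {p | p.1 ∈ X ∧ p.2 ≠ 0 ∧ ¬ MicroRegular hs X f p.1 p.2}

/-- The weight `w_k(ξ) = e^{k|ξ|^{1/s}}`. -/
def expWeight {d : ℕ} (s k : ℝ) (ξ : Rd d) : ℝ := Real.exp (k * ‖ξ‖ ^ (1 / s))

end UltraWF

end

/-! Fix `(x₀, ξ₀)`. If some cut-off equal to `1` near `x₀` gives decay `e^{-k|ξ|^{1/s}}` in a cone,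
then the weight with `k/2` leaves `e^{-(k/2)|ξ|^{1/s}}`, which lies in every `L^q`; so the point is
missing from the wave-front set for `ω_{k/2}`, hence from the intersection.

Conversely, let `u = φ f` have finite seminorm for one `k > 0`, one cone `Γ ∋ ξ₀` and one `φ` with
`φ(x₀) ≠ 0`. Choose a cut-off `χ`, equal to `1` near `x₀` and supported where `φ ≠ 0`, and put `ψ =
χ/φ`. Then `χ f = ψ u`, whose Fourier transform is a convolution of those of `ψ` and `u`. Hölder
turns the `L^q` bound on `Γ` into an `L^1` bound with weight `e^{(k/2)|ξ|^{1/s}}`. For `ξ` in a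
smaller cone, the part of the convolution near `ξ` stays in `Γ` and inherits decay from this bound;
in the remaining part the transform of `ψ` decays faster than that of `u` can grow
(`exists_cone_decay_mul`).

Three facts carry this. The class is closed under division by nonvanishing functions
(`mul_inv_mem_DBeurling`): in the normalized Leibniz formula the binomial coefficients enter with
exponent `1 - s < 0`, which makes the recursion for the derivatives of the quotient contractive.
Cut-offs exist (`exists_cutoff`): `exp(-t^{-a})` has Gevrey order `1 + 1/a`, less than `s` for large
`a`. The convolution formula holds (`apply_mul_expFun`): by Hahn–Banach the functional extends to a
Banach space of jets, where it commutes with Bochner integrals of exponentials. -/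

noncomputable section

namespace UltraWF

open Filter MeasureTheory FourierTransform

/-! ### Division in Gevrey classes of Beurling type -/

/-- A family of sequences whose `n`-th term is controlled by a constant and by a small multiple of
a geometrically weighted sum of the preceding terms is bounded. -/
theorem exists_bound_of_recursion {ι : Type*} {u : ι → ℕ → ℝ} {κ : ℕ → ℝ} {C : ℝ}
    (hκ : ∀ n, 0 ≤ κ n) (hκ0 : Tendsto κ atTop (𝓝 0))
    (h : ∀ x n, u x n ≤ C + κ n * ∑ i ∈ Finset.range n, (1 / 2 : ℝ) ^ (n - i) * u x i) :
    ∃ M, ∀ x n, u x n ≤ M := by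
  have hgeo : ∀ n : ℕ, ∑ i ∈ Finset.range n, (1 / 2 : ℝ) ^ (n - i) ≤ 1 := by
    intro n
    have : ∑ i ∈ Finset.range n, (1 / 2 : ℝ) ^ (n - i) = 1 - (1 / 2) ^ n := by
      induction n with
      | zero => simp
      | succ n ih =>
        have h2 : ∀ i ∈ Finset.range n, (1 / 2 : ℝ) ^ (n + 1 - i) = (1 / 2) * (1 / 2) ^ (n - i) := by
          intro i hi
          rw [Nat.sub_add_comm (Finset.mem_range.mp hi).le, pow_succ]
          ring
        rw [Finset.sum_range_succ, Finset.sum_congr rfl h2, ← Finset.mul_sum, ih]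
        simp [pow_succ]
        ring
    rw [this]
    have : (0 : ℝ) ≤ (1 / 2) ^ n := by positivity
    linarith
  have hstep : ∀ (x : ι) (n : ℕ) (M : ℝ), (∀ i < n, u x i ≤ M) → 0 ≤ M → u x n ≤ C + κ n * M := by
    intro x n M hM hM0
    refine (h x n).trans (add_le_add_right (mul_le_mul_of_nonneg_left ?_ (hκ n)) _)
    calc ∑ i ∈ Finset.range n, (1 / 2 : ℝ) ^ (n - i) * u x i
        ≤ ∑ i ∈ Finset.range n, (1 / 2 : ℝ) ^ (n - i) * M := Finset.sum_le_sum fun i hi =>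
          mul_le_mul_of_nonneg_left (hM i (Finset.mem_range.mp hi)) (by positivity)
      _ = (∑ i ∈ Finset.range n, (1 / 2 : ℝ) ^ (n - i)) * M := by rw [Finset.sum_mul]
      _ ≤ M := mul_le_of_le_one_left hM0 (hgeo n)
  have hfin : ∀ N : ℕ, ∃ M, 0 ≤ M ∧ ∀ x, ∀ n < N, u x n ≤ M := by
    intro N
    induction N with
    | zero => exact ⟨0, le_rfl, by simp⟩
    | succ N ih =>
      obtain ⟨M, hM0, hM⟩ := ih
      refine ⟨max M (C + κ N * M), le_max_of_le_left hM0, fun x n hn => ?_⟩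
      rcases Nat.lt_succ_iff_lt_or_eq.mp hn with hn | rfl
      · exact (hM x n hn).trans (le_max_left _ _)
      · exact (hstep x n M (hM x) hM0).trans (le_max_right _ _)
  obtain ⟨N, hN⟩ := eventually_atTop.mp (hκ0.eventually (gt_mem_nhds (show (0 : ℝ) < 1 / 2 by norm_num)))
  obtain ⟨M, hM0, hM⟩ := hfin N
  -- Once `κ n < 1/2`, the bound `M'` propagates as soon as `C + M'/2 ≤ M'`, that is, `M' ≥ 2 * C`.
  refine ⟨max M (2 * C), fun x n => ?_⟩
  induction n using Nat.strong_induction_on with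
  | _ n ih =>
    rcases lt_or_ge n N with hn | hn
    · exact (hM x n hn).trans (le_max_left _ _)
    · have h0 : 0 ≤ max M (2 * C) := le_max_of_le_left hM0
      have h1 := hstep x n _ ih h0
      have h2 := mul_le_mul_of_nonneg_right (hN n hn).le h0
      have h3 := le_max_right M (2 * C)
      linarith

/-- Finiteness of a Gevrey norm as a bound by a real constant. -/
theorem ultraNorm_lt_top_iff {d : ℕ} {s A : ℝ} (hA : 0 < A) {K : Set (Rd d)} {g : Rd d → ℂ} :
    ultraNorm s A K g < ⊤ ↔
      ∃ C : ℝ, 0 ≤ C ∧ ∀ n, ∀ x ∈ K, A ^ n / (n.factorial : ℝ) ^ s * ‖iteratedFDeriv ℝ n g x‖ ≤ C := by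
  constructor
  · intro h
    refine ⟨(ultraNorm s A K g).toReal, ENNReal.toReal_nonneg, fun n x hx => ?_⟩
    have := ENNReal.toReal_mono h.ne (le_ultraNorm s A g n hx)
    rwa [ENNReal.toReal_mul, ENNReal.toReal_ofReal (by positivity), toReal_enorm] at this
  · rintro ⟨C, -, h⟩
    refine lt_of_le_of_lt (iSup_le fun n => iSup₂_le fun x hx => ?_) (ENNReal.ofReal_lt_top (r := C))
    rw [← ofReal_norm, ← ENNReal.ofReal_mul (by positivity)]
    exact ENNReal.ofReal_le_ofReal (h n x hx)

theorem le_choose_of_pos_of_lt {n i : ℕ} (hi : 0 < i) (hin : i < n) : n ≤ n.choose i := by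
  induction n generalizing i with
  | zero => omega
  | succ n ih =>
    obtain ⟨i, rfl⟩ : ∃ m, i = m + 1 := ⟨i - 1, by omega⟩
    rw [Nat.choose_succ_succ]
    rcases Nat.lt_or_ge (i + 1) n with h | h
    · have := ih (Nat.succ_pos i) h
      have := Nat.choose_pos (n := n) (k := i) (by omega)
      omega
    · obtain rfl : n = i + 1 := by omega
      simp

/-- With `b` the binomial coefficient, the left side is exactly `b ^ (1 - s) * (n!) ^ s`, and `b ≥
n` away from the two ends of the row. The factor `n ^ (1 - s)` tends to `0`; this gain makes
division possible without loss in the parameter `A`. -/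
theorem choose_mul_gevrey_le {s : ℝ} (hs : 1 < s) {n i : ℕ} (hi : 0 < i) (hin : i < n) :
    (n.choose i : ℝ) * ((i.factorial : ℝ) ^ s * ((n - i).factorial : ℝ) ^ s) ≤
      (n : ℝ) ^ (1 - s) * (n.factorial : ℝ) ^ s := by
  have hfac : (n.choose i : ℝ) * (i.factorial : ℝ) * ((n - i).factorial : ℝ) = (n.factorial : ℝ) := by
    exact_mod_cast Nat.choose_mul_factorial_mul_factorial hin.le
  have hn : (0 : ℝ) < n := by exact_mod_cast hi.trans hin
  have hc : (n : ℝ) ≤ n.choose i := by exact_mod_cast le_choose_of_pos_of_lt hi hin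
  have hc0 : (0 : ℝ) < n.choose i := hn.trans_le hc
  have h1 : ((n.choose i : ℕ) : ℝ) ^ (1 - s) ≤ (n : ℝ) ^ (1 - s) :=
    Real.rpow_le_rpow_of_nonpos hn hc (by linarith)
  have h2 : (n.choose i : ℝ) = (n.choose i : ℝ) ^ (1 - s) * (n.choose i : ℝ) ^ s := by
    rw [← Real.rpow_add hc0]
    simp
  rw [← hfac, Real.mul_rpow (by positivity) (by positivity),
    Real.mul_rpow (by positivity) (by positivity)]
  nth_rewrite 1 [h2]
  have : 0 ≤ (n.choose i : ℝ) ^ s * ((i.factorial : ℝ) ^ s * ((n - i).factorial : ℝ) ^ s) := by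
    positivity
  nlinarith [mul_le_mul_of_nonneg_right h1 this]

/-- The Leibniz estimate with the term `g(x) • D^n ψ(x)` removed. -/
theorem norm_iteratedFDeriv_mul_sub_le {E : Type*} [NormedAddCommGroup E] [NormedSpace ℝ E]
    {g ψ : E → ℂ} (hg : ContDiff ℝ ∞ g) (hψ : ContDiff ℝ ∞ ψ) (n : ℕ) (x : E) :
    ‖g x‖ * ‖iteratedFDeriv ℝ n ψ x‖ ≤ ‖iteratedFDeriv ℝ n (ψ * g) x‖ +
      ∑ i ∈ Finset.range n, (n.choose i : ℝ) * ‖iteratedFDeriv ℝ i ψ x‖ *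
        ‖iteratedFDeriv ℝ (n - i) g x‖ := by
  have hle : ∀ n : ℕ, (n : ℕ∞ω) ≤ ((⊤ : ℕ∞) : ℕ∞ω) := fun n => by exact_mod_cast le_top
  -- Subtracting the constant `g x` kills the top term `i = n` of the Leibniz formula at `x` and
  -- leaves every derivative of `g` of positive order unchanged.
  set g₀ : E → ℂ := fun y => g y - g x with hg₀
  have hg₀s : ContDiff ℝ ∞ g₀ := hg.sub contDiff_const
  have heq : ψ * g = g x • ψ + ψ * g₀ := by
    funext y
    simp [hg₀]
    ring
  have hL := norm_iteratedFDeriv_mul_le (𝕜 := ℝ) (N := ∞) hψ hg₀s x (n := n) (hle n)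
  rw [Finset.sum_range_succ] at hL
  have h0 : ‖iteratedFDeriv ℝ (n - n) g₀ x‖ = 0 := by
    rw [Nat.sub_self, norm_iteratedFDeriv_zero]
    simp [hg₀]
  rw [h0, mul_zero, add_zero] at hL
  have hsum : ∀ i ∈ Finset.range n, (n.choose i : ℝ) * ‖iteratedFDeriv ℝ i ψ x‖ *
      ‖iteratedFDeriv ℝ (n - i) g₀ x‖ = (n.choose i : ℝ) * ‖iteratedFDeriv ℝ i ψ x‖ *
        ‖iteratedFDeriv ℝ (n - i) g x‖ := by
    intro i hi
    have hne : n - i ≠ 0 := by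
      have := Finset.mem_range.mp hi
      omega
    have : g₀ = g - fun _ => g x := rfl
    rw [this, iteratedFDeriv_sub_apply ((hg.of_le (hle _)).contDiffAt) contDiff_const.contDiffAt,
      iteratedFDeriv_const_of_ne hne]
    simp
  rw [Finset.sum_congr rfl hsum] at hL
  have hsplit : iteratedFDeriv ℝ n (ψ * g) x =
      g x • iteratedFDeriv ℝ n ψ x + iteratedFDeriv ℝ n (ψ * g₀) x := by
    rw [heq, iteratedFDeriv_add_apply (f := g x • ψ) (g := ψ * g₀)
      (((hψ.of_le (hle n)).const_smul (g x)).contDiffAt)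
      (((hψ.mul hg₀s).of_le (hle n)).contDiffAt),
      iteratedFDeriv_const_smul_apply ((hψ.of_le (hle n)).contDiffAt)]
  have hb : g x • iteratedFDeriv ℝ n ψ x =
      iteratedFDeriv ℝ n (ψ * g) x - iteratedFDeriv ℝ n (ψ * g₀) x := by
    rw [hsplit]
    abel
  rw [← norm_smul, hb]
  exact (norm_sub_le _ _).trans (add_le_add_right hL _)

theorem contDiff_mul_inv {E : Type*} [NormedAddCommGroup E] [NormedSpace ℝ E]
    {χ φ : E → ℂ} (hχ : ContDiff ℝ ∞ χ) (hφ : ContDiff ℝ ∞ φ)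
    (hne : ∀ x ∈ tsupport χ, φ x ≠ 0) : ContDiff ℝ ∞ (χ * φ⁻¹) := by
  rw [contDiff_iff_contDiffAt]
  intro x
  by_cases hx : x ∈ tsupport χ
  · exact hχ.contDiffAt.mul (hφ.contDiffAt.inv (hne x hx))
  · refine (contDiffAt_const (c := (0 : ℂ))).congr_of_eventuallyEq ?_
    filter_upwards [notMem_tsupport_iff_eventuallyEq.mp hx] with y hy
    simp [hy]

/-- Division in `𝒟^{(s)}(X)`. -/
theorem mul_inv_mem_DBeurling {d : ℕ} {s : ℝ} (hs : 1 < s) {X : Set (Rd d)} {χ φ : Rd d → ℂ}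
    (hχ : χ ∈ DBeurling s X) (hφ : φ ∈ EBeurling d s) (hne : ∀ x ∈ tsupport χ, φ x ≠ 0) :
    χ * φ⁻¹ ∈ DBeurling s X := by
  have hsub : tsupport (χ * φ⁻¹) ⊆ tsupport χ := tsupport_mul_subset_left
  have hsm : ContDiff ℝ ∞ (χ * φ⁻¹) := contDiff_mul_inv hχ.1.1 hφ.1 hne
  refine ⟨⟨hsm, fun K hK A hA => ?_⟩, hχ.2.1.mul_right, hsub.trans hχ.2.2⟩
  set S := tsupport χ with hS
  have hSc : IsCompact S := hχ.2.1
  set ψ := χ * φ⁻¹ with hψ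
  -- Measuring `φ` with `2 * A` instead of `A` supplies the weights `(1 / 2) ^ (n - i)` of the
  -- recursion.
  obtain ⟨Ca, hCa0, hCa⟩ := (ultraNorm_lt_top_iff (by positivity)).mp (hφ.2 S hSc (2 * A) (by positivity))
  obtain ⟨Cb, hCb0, hCb⟩ := (ultraNorm_lt_top_iff hA).mp (hχ.1.2 S hSc A hA)
  obtain ⟨m, hm, hmS⟩ : ∃ m : ℝ, 0 < m ∧ ∀ x ∈ S, m ≤ ‖φ x‖ := by
    rcases S.eq_empty_or_nonempty with he | hne'
    · exact ⟨1, one_pos, by simp [he]⟩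
    · obtain ⟨x, hx, hmin⟩ := hSc.exists_isMinOn hne' hφ.1.continuous.norm.continuousOn
      exact ⟨‖φ x‖, norm_pos_iff.mpr (hne x hx), fun y hy => hmin hy⟩
  set u : S → ℕ → ℝ := fun x n => A ^ n / (n.factorial : ℝ) ^ s * ‖iteratedFDeriv ℝ n ψ x‖ with hu
  have hu0 : ∀ x n, 0 ≤ u x n := fun x n => by positivity
  have hprod : ∀ x, (ψ * φ) x = χ x := by
    intro x
    by_cases hx : x ∈ S
    · simp [hψ, hne x hx]
    · simp [hψ, image_eq_zero_of_notMem_tsupport hx]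
  -- The term `i = 0` has binomial coefficient `1` and no gain `n ^ (1 - s)`; it is moved into the
  -- constant, where `hzero` bounds it uniformly in `x`.
  have hmain : ∀ x n, m * u x n ≤ Cb + Ca * u x 0 +
      Ca * (n : ℝ) ^ (1 - s) * ∑ i ∈ Finset.range n, (1 / 2 : ℝ) ^ (n - i) * u x i := by
    intro x n
    have hL := norm_iteratedFDeriv_mul_sub_le hφ.1 hsm n (x : Rd d)
    rw [show ψ * φ = χ from funext hprod] at hL
    have hc : 0 ≤ A ^ n / (n.factorial : ℝ) ^ s := by positivity
    have h1 : m * u x n ≤ A ^ n / (n.factorial : ℝ) ^ s *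
        (‖φ x‖ * ‖iteratedFDeriv ℝ n ψ x‖) := by
      have := mul_le_mul_of_nonneg_right (hmS x x.2) (hu0 x n)
      simp only [hu] at this ⊢
      linarith
    have h2 := mul_le_mul_of_nonneg_left hL hc
    rw [mul_add, Finset.mul_sum] at h2
    have hterm : ∀ i ∈ Finset.range n, A ^ n / (n.factorial : ℝ) ^ s *
        ((n.choose i : ℝ) * ‖iteratedFDeriv ℝ i ψ x‖ * ‖iteratedFDeriv ℝ (n - i) φ x‖) ≤
        (if i = 0 then Ca * u x 0 else 0) +
          Ca * (n : ℝ) ^ (1 - s) * ((1 / 2 : ℝ) ^ (n - i) * u x i) := by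
      intro i hi
      have hin := Finset.mem_range.mp hi
      have ha := hCa (n - i) x x.2
      have ha' : A ^ (n - i) / ((n - i).factorial : ℝ) ^ s * ‖iteratedFDeriv ℝ (n - i) φ x‖ ≤
          Ca * (1 / 2) ^ (n - i) := by
        have : A ^ (n - i) = (2 * A) ^ (n - i) * (1 / 2) ^ (n - i) := by
          rw [← mul_pow]
          congr 1
          ring
        rw [this]
        have := mul_le_mul_of_nonneg_right ha (show (0 : ℝ) ≤ (1 / 2) ^ (n - i) by positivity)
        calc _ = _ := by ring
          _ ≤ _ := this
      have hfi : (0 : ℝ) < (i.factorial : ℝ) ^ s := Real.rpow_pos_of_pos (by positivity) s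
      have hfni : (0 : ℝ) < ((n - i).factorial : ℝ) ^ s := Real.rpow_pos_of_pos (by positivity) s
      have hfn : (0 : ℝ) < (n.factorial : ℝ) ^ s := Real.rpow_pos_of_pos (by positivity) s
      have hre : A ^ n / (n.factorial : ℝ) ^ s *
          ((n.choose i : ℝ) * ‖iteratedFDeriv ℝ i ψ x‖ * ‖iteratedFDeriv ℝ (n - i) φ x‖) =
          ((n.choose i : ℝ) * ((i.factorial : ℝ) ^ s * ((n - i).factorial : ℝ) ^ s) /
            (n.factorial : ℝ) ^ s) * (u x i * (A ^ (n - i) / ((n - i).factorial : ℝ) ^ s *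
              ‖iteratedFDeriv ℝ (n - i) φ x‖)) := by
        have : A ^ n = A ^ i * A ^ (n - i) := by
          rw [← pow_add, Nat.add_sub_cancel' hin.le]
        rw [this]
        simp only [hu]
        field_simp
      have hw : u x i * (A ^ (n - i) / ((n - i).factorial : ℝ) ^ s *
          ‖iteratedFDeriv ℝ (n - i) φ x‖) ≤ u x i * (Ca * (1 / 2) ^ (n - i)) :=
        mul_le_mul_of_nonneg_left ha' (hu0 x i)
      rw [hre]
      rcases Nat.eq_zero_or_pos i with rfl | hipos
      · have hone : (n.choose 0 : ℝ) * (((0 : ℕ).factorial : ℝ) ^ s * ((n - 0).factorial : ℝ) ^ s) /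
            (n.factorial : ℝ) ^ s = 1 := by
          simp [hfn.ne']
        rw [hone, one_mul, if_pos rfl]
        have h5 : (1 / 2 : ℝ) ^ (n - 0) ≤ 1 := pow_le_one₀ (by norm_num) (by norm_num)
        have h6 : 0 ≤ Ca * (n : ℝ) ^ (1 - s) * ((1 / 2 : ℝ) ^ (n - 0) * u x 0) := by
          have := hu0 x 0
          positivity
        have h7 := mul_le_mul_of_nonneg_left h5 (mul_nonneg (hu0 x 0) hCa0)
        linarith
      · rw [if_neg hipos.ne', zero_add]
        calc _ ≤ (n : ℝ) ^ (1 - s) * (u x i * (Ca * (1 / 2) ^ (n - i))) := by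
              refine mul_le_mul ?_ hw ?_ (by positivity)
              · rw [div_le_iff₀ hfn]
                exact choose_mul_gevrey_le hs hipos hin
              · have := hu0 x i
                positivity
          _ = _ := by ring
    have h3 := Finset.sum_le_sum hterm
    rw [Finset.sum_add_distrib, ← Finset.mul_sum (Finset.range n) _ (Ca * (n : ℝ) ^ (1 - s))] at h3
    have h4 : ∑ i ∈ Finset.range n, (if i = 0 then Ca * u x 0 else 0) ≤ Ca * u x 0 := by
      rw [Finset.sum_ite_eq' (Finset.range n) 0 (fun _ => Ca * u x 0)]
      split_ifs
      · exact le_rfl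
      · exact mul_nonneg hCa0 (hu0 x 0)
    have h5 := hCb n x x.2
    linarith
  have hzero : ∀ x, u x 0 ≤ Cb / m := by
    intro x
    rw [le_div_iff₀ hm, mul_comm]
    have h5 := hCb 0 x x.2
    have h6 : u x 0 = ‖ψ x‖ := by simp [hu]
    have h7 : ‖χ x‖ = ‖ψ x‖ * ‖φ x‖ := by rw [← norm_mul, ← hprod x]; rfl
    have h8 : ‖χ x‖ ≤ Cb := by simpa using h5
    rw [h6]
    nlinarith [mul_le_mul_of_nonneg_left (hmS x x.2) (norm_nonneg (ψ x))]
  have hlim : Tendsto (fun n : ℕ => Ca / m * (n : ℝ) ^ (1 - s)) atTop (𝓝 0) := by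
    have h1 := (tendsto_rpow_neg_atTop (show 0 < s - 1 by linarith)).comp tendsto_natCast_atTop_atTop
    simpa [Function.comp_def, neg_sub] using h1.const_mul (Ca / m)
  obtain ⟨M, hM⟩ := exists_bound_of_recursion (u := u) (C := (Cb + Ca * (Cb / m)) / m)
    (κ := fun n : ℕ => Ca / m * (n : ℝ) ^ (1 - s)) (fun n => by positivity) hlim (by
      intro x n
      have h1 := hmain x n
      have h2 := mul_le_mul_of_nonneg_left (hzero x) hCa0
      rw [← mul_le_mul_iff_right₀ hm]
      calc m * u x n ≤ _ := h1
        _ ≤ Cb + Ca * (Cb / m) +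
          Ca * (n : ℝ) ^ (1 - s) * ∑ i ∈ Finset.range n, (1 / 2 : ℝ) ^ (n - i) * u x i := by linarith
        _ = _ := by field_simp)
  refine (ultraNorm_lt_top_iff hA).mpr ⟨max M 0, le_max_right _ _, fun n x _ => ?_⟩
  by_cases hx : x ∈ S
  · exact (hM ⟨x, hx⟩ n).trans (le_max_left _ _)
  · have : iteratedFDeriv ℝ n ψ x = 0 := by
      by_contra hne0
      exact hx (hsub (support_iteratedFDeriv_subset n (𝕜 := ℝ) hne0))
    rw [this]
    simp

/-! ### Flat functions and cut-offs -/

theorem pow_le_factorial_rpow_mul_exp {s t : ℝ} (hs : 0 < s) (ht : 0 ≤ t) (n : ℕ) :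
    t ^ n ≤ (n.factorial : ℝ) ^ s * Real.exp (s * t ^ (1 / s)) := by
  have h0 : 0 ≤ t ^ (1 / s) := Real.rpow_nonneg ht _
  have h1 : (t ^ (1 / s)) ^ n ≤ (n.factorial : ℝ) * Real.exp (t ^ (1 / s)) := by
    have := Real.pow_div_factorial_le_exp (t ^ (1 / s)) h0 n
    rwa [div_le_iff₀ (by positivity), mul_comm] at this
  -- The exponential series bound at `t ^ (1 / s)`, raised to the power `s`.
  have h2 := Real.rpow_le_rpow (by positivity) h1 hs.le
  rw [Real.mul_rpow (by positivity) (by positivity), ← Real.exp_mul, mul_comm (t ^ (1 / s)) s] at h2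
  have h3 : ((t ^ (1 / s)) ^ n) ^ s = t ^ n := by
    rw [← Real.rpow_natCast, ← Real.rpow_natCast, ← Real.rpow_mul ht, ← Real.rpow_mul ht]
    congr 1
    field_simp
  rwa [h3] at h2

/-- The function `t ↦ exp(-t^{-a})`, `t > 0`, extended by zero; `a` is odd in all uses. -/
def flatExp (a : ℕ) (t : ℝ) : ℂ := ((expNegInvGlue (t ^ a) : ℝ) : ℂ)

/-- The holomorphic extension of `flatExp` off the negative half axis. -/
def flatExpC (a : ℕ) (z : ℂ) : ℂ := Complex.exp (-(z ^ a)⁻¹)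

theorem contDiff_flatExp (a : ℕ) : ContDiff ℝ ∞ (flatExp a) :=
  Complex.ofRealCLM.contDiff.comp (expNegInvGlue.contDiff.comp (contDiff_id.pow a))

theorem flatExp_of_pos {a : ℕ} {t : ℝ} (ht : 0 < t) : flatExp a t = flatExpC a t := by
  have : ¬ t ^ a ≤ 0 := not_le.mpr (pow_pos ht a)
  simp [flatExp, flatExpC, expNegInvGlue, this]

theorem flatExp_of_nonpos {a : ℕ} (ha : Odd a) {t : ℝ} (ht : t ≤ 0) : flatExp a t = 0 := by
  simp [flatExp, expNegInvGlue.zero_of_nonpos (ha.pow_nonpos ht)]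

theorem analyticAt_flatExpC (a : ℕ) {z : ℂ} (hz : z ≠ 0) : AnalyticAt ℂ (flatExpC a) z :=
  (((analyticAt_id.pow a).inv (pow_ne_zero a hz)).neg).cexp

/-- On the open half line real derivatives are restrictions of complex ones; this makes Cauchy
estimates available. -/
theorem iteratedDeriv_flatExp_of_pos (a n : ℕ) {t : ℝ} (ht : 0 < t) :
    iteratedDeriv n (flatExp a) t = iteratedDeriv n (flatExpC a) t := by
  induction n generalizing t with
  | zero => simpa using flatExp_of_pos ht
  | succ n ih =>
    have hev : iteratedDeriv n (flatExp a) =ᶠ[𝓝 t] fun r : ℝ => iteratedDeriv n (flatExpC a) r := by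
      filter_upwards [lt_mem_nhds ht] with r hr using ih hr
    have hd : HasDerivAt (iteratedDeriv n (flatExpC a)) (iteratedDeriv (n + 1) (flatExpC a) t) t := by
      have han : AnalyticAt ℂ (iteratedDeriv n (flatExpC a)) t := by
        rw [iteratedDeriv_eq_iterate]
        exact (analyticAt_flatExpC a (by exact_mod_cast ht.ne')).iterated_deriv n
      rw [iteratedDeriv_succ]
      exact han.differentiableAt.hasDerivAt
    rw [iteratedDeriv_succ, hev.deriv_eq, hd.comp_ofReal.deriv]

/-- Clear for `t < 0`; the endpoint `0` follows because the zero set of a continuous derivative is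
closed. -/
theorem iteratedDeriv_flatExp_of_nonpos {a : ℕ} (ha : Odd a) (n : ℕ) {t : ℝ} (ht : t ≤ 0) :
    iteratedDeriv n (flatExp a) t = 0 := by
  have hcl : IsClosed {r : ℝ | iteratedDeriv n (flatExp a) r = 0} :=
    isClosed_eq ((contDiff_flatExp a).continuous_iteratedDeriv n (by exact_mod_cast le_top))
      continuous_const
  have hsub : Set.Iio (0 : ℝ) ⊆ {r : ℝ | iteratedDeriv n (flatExp a) r = 0} := by
    intro r hr
    have hev : flatExp a =ᶠ[𝓝 r] fun _ => 0 := by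
      filter_upwards [gt_mem_nhds (show r < 0 from hr)] with y hy using flatExp_of_nonpos ha hy.le
    simp [hev.iteratedDeriv_eq n]
  have := hcl.closure_subset_iff.mpr hsub
  rw [closure_Iio] at this
  exact this ht

/-- Cauchy estimates on discs of radius proportional to the distance to the origin. -/
theorem exists_norm_iteratedDeriv_flatExp_le (a : ℕ) :
    ∃ ε : ℝ, 0 < ε ∧ ∀ n : ℕ, ∀ t : ℝ, 0 < t →
      ‖iteratedDeriv n (flatExp a) t‖ ≤
        n.factorial * Real.exp (-((t ^ a)⁻¹ / 2)) / (ε * t) ^ n := by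
  -- By homogeneity `z⁻ᵃ = t⁻ᵃ (z/t)⁻ᵃ`, so it suffices to keep the real part of `w⁻ᵃ` at least
  -- `1/2` for `w` near `1`.
  have hcont : ContinuousAt (fun w : ℂ => (w ^ a)⁻¹) 1 :=
    (continuousAt_id.pow a).inv₀ (by simp)
  obtain ⟨δ, hδ, hball⟩ := Metric.continuousAt_iff.mp hcont (1 / 2) (by norm_num)
  -- Halving makes the radius strictly smaller than both `δ` and `1`: the closed disc of radius `ε *
  -- t` around `t` avoids `0`, and its rescaling to `1` stays in the `δ`-ball.
  refine ⟨min δ 1 / 2, by positivity, fun n t ht => ?_⟩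
  set ε := min δ 1 / 2 with hε
  have hε0 : 0 < ε := by positivity
  have hε1 : ε < 1 := by
    have := min_le_right δ 1
    linarith
  have hεδ : ε < δ := by
    have := min_le_left δ 1
    have : 0 < min δ 1 := by positivity
    linarith
  have hin : ∀ z ∈ Metric.closedBall (t : ℂ) (ε * t), z ≠ 0 := by
    rintro z hz rfl
    rw [mem_closedBall_iff_norm] at hz
    simp [abs_of_pos ht] at hz
    nlinarith
  rw [iteratedDeriv_flatExp_of_pos a n ht]
  refine Complex.norm_iteratedDeriv_le_of_forall_mem_sphere_norm_le n (by positivity) ?_ ?_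
  · refine DifferentiableOn.diffContOnCl fun z hz => ?_
    refine (analyticAt_flatExpC a (hin z ?_)).differentiableAt.differentiableWithinAt
    exact Metric.closure_ball_subset_closedBall hz
  · intro z hz
    have htC : (t : ℂ) ≠ 0 := by exact_mod_cast ht.ne'
    have hw : dist (z / t) 1 < δ := by
      have h1 : z / t - 1 = (z - t) / t := by field_simp
      rw [dist_eq_norm, h1, norm_div, mem_sphere_iff_norm.mp hz, Complex.norm_real,
        Real.norm_of_nonneg ht.le, mul_div_assoc, div_self ht.ne', mul_one]
      exact hεδ
    have h2 := hball hw
    rw [dist_eq_norm] at h2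
    simp only [one_pow, inv_one] at h2
    have h3 : 1 / 2 ≤ (((z / t) ^ a)⁻¹).re := by
      have := (Complex.abs_re_le_norm _).trans h2.le
      rw [Complex.sub_re, Complex.one_re, abs_le] at this
      linarith [this.1]
    have h4 : (z ^ a)⁻¹ = (((t ^ a)⁻¹ : ℝ) : ℂ) * ((z / t) ^ a)⁻¹ := by
      rw [div_pow, inv_div]
      push_cast
      field_simp
    rw [flatExpC, Complex.norm_exp, Complex.neg_re, h4, Complex.re_ofReal_mul]
    refine Real.exp_le_exp.mpr (neg_le_neg ?_)
    have : 0 ≤ (t ^ a)⁻¹ := by positivity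
    nlinarith [mul_le_mul_of_nonneg_left h3 this]

/-- The Cauchy bound `n! (ε t)⁻ⁿ exp(-t⁻ᵃ/2)`, maximized over `t`, grows like `(n!)^{1 + 1/a}` up to
geometric factors. Since `1 + 1/a < s`, a positive power of `n!` is left over to absorb `A ^ n` for
every `A`. The estimate is made for `a`-th powers to avoid roots. -/
theorem exists_flatExp_gevrey_bound {s : ℝ} {a : ℕ} (ha : Odd a) (has : 1 < (s - 1) * a)
    {A : ℝ} (hA : 0 < A) :
    ∃ C : ℝ, 0 ≤ C ∧ ∀ n : ℕ, ∀ t : ℝ,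
      A ^ n / (n.factorial : ℝ) ^ s * ‖iteratedDeriv n (flatExp a) t‖ ≤ C := by
  obtain ⟨ε, hε, hbd⟩ := exists_norm_iteratedDeriv_flatExp_le a
  have ha0 : (0 : ℝ) < a := by exact_mod_cast ha.pos
  -- The spare power of `n!` after taking `a`-th powers; it dominates `D ^ n` at the cost of the
  -- constant `C`.
  set τ := (s - 1) * a - 1 with hτ
  have hτ0 : 0 < τ := by linarith
  set B := A / ε with hB
  have hB0 : 0 < B := by positivity
  -- Chosen so that `D * (a * y / 2) = (B / t) ^ a`, which matches the variable of the exponential.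
  set D := 2 * B ^ a / a with hD
  have hD0 : 0 < D := by positivity
  set C := Real.exp (τ * D ^ (1 / τ)) with hC
  have hC0 : 0 < C := Real.exp_pos _
  refine ⟨C ^ (1 / (a : ℝ)), by positivity, fun n t => ?_⟩
  rcases le_or_gt t 0 with ht | ht
  · rw [iteratedDeriv_flatExp_of_nonpos ha n ht]
    simp
    positivity
  have hn0 : (0 : ℝ) < n.factorial := by positivity
  have hns : (0 : ℝ) < (n.factorial : ℝ) ^ s := Real.rpow_pos_of_pos hn0 s
  set y := (t ^ a)⁻¹ with hy
  have hy0 : 0 < y := by positivity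
  -- the `a`-th power of the quantity to be bounded
  have hpow : ((B / t) ^ n * Real.exp (-(y / 2))) ^ a ≤ n.factorial * D ^ n := by
    have h1 : ((B / t) ^ n * Real.exp (-(y / 2))) ^ a =
        D ^ n * ((a * y / 2) ^ n * Real.exp (-(a * y / 2))) := by
      have h2 : D * (a * y / 2) = (B / t) ^ a := by
        rw [hD, hy, div_pow B t]
        field_simp
      rw [← mul_assoc, ← mul_pow, h2, mul_pow, ← pow_mul, ← pow_mul, mul_comm n a, ← Real.exp_nat_mul]
      congr 2
      ring
    have h3 := Real.pow_div_factorial_le_exp (a * y / 2) (by positivity) n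
    rw [div_le_iff₀ (by positivity)] at h3
    have h4 : (a * y / 2) ^ n * Real.exp (-(a * y / 2)) ≤ n.factorial := by
      rw [Real.exp_neg, ← div_eq_mul_inv, div_le_iff₀ (Real.exp_pos _)]
      linarith
    rw [h1, mul_comm]
    exact mul_le_mul_of_nonneg_right h4 (by positivity)
  have hpow2 : (n.factorial : ℝ) * D ^ n ≤ (C ^ (1 / (a : ℝ)) * (n.factorial : ℝ) ^ (s - 1)) ^ a := by
    have h1 := pow_le_factorial_rpow_mul_exp hτ0 hD0.le n
    have h2 : (C ^ (1 / (a : ℝ)) * (n.factorial : ℝ) ^ (s - 1)) ^ a =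
        C * ((n.factorial : ℝ) * (n.factorial : ℝ) ^ τ) := by
      rw [mul_pow, ← Real.rpow_natCast, ← Real.rpow_natCast, ← Real.rpow_mul hC0.le,
        ← Real.rpow_mul hn0.le, one_div, inv_mul_cancel₀ ha0.ne', Real.rpow_one]
      congr 1
      nth_rewrite 2 [← Real.rpow_one (n.factorial : ℝ)]
      rw [← Real.rpow_add hn0]
      congr 1
      ring
    rw [h2]
    calc (n.factorial : ℝ) * D ^ n ≤ n.factorial * ((n.factorial : ℝ) ^ τ * C) :=
          mul_le_mul_of_nonneg_left h1 hn0.le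
      _ = _ := by ring
  have hle := (pow_le_pow_iff_left₀ (by positivity) (by positivity) ha.pos.ne').mp (hpow.trans hpow2)
  calc A ^ n / (n.factorial : ℝ) ^ s * ‖iteratedDeriv n (flatExp a) t‖
      ≤ A ^ n / (n.factorial : ℝ) ^ s *
        (n.factorial * Real.exp (-((t ^ a)⁻¹ / 2)) / (ε * t) ^ n) :=
        mul_le_mul_of_nonneg_left (hbd n t ht) (by positivity)
    _ = n.factorial / (n.factorial : ℝ) ^ s * ((B / t) ^ n * Real.exp (-(y / 2))) := by
        rw [hB, div_div, div_pow]
        ring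
    _ ≤ n.factorial / (n.factorial : ℝ) ^ s * (C ^ (1 / (a : ℝ)) * (n.factorial : ℝ) ^ (s - 1)) :=
        mul_le_mul_of_nonneg_left hle (by positivity)
    _ = C ^ (1 / (a : ℝ)) := by
        rw [Real.rpow_sub hn0, Real.rpow_one]
        field_simp

/-- Superposition of `flatExp` with an affine function. -/
theorem flatExp_comp_mem_EBeurling {d : ℕ} {s : ℝ} {a : ℕ} (ha : Odd a) (has : 1 < (s - 1) * a)
    (l : Rd d →L[ℝ] ℝ) (c : ℝ) : (fun x => flatExp a (l x + c)) ∈ EBeurling d s := by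
  have hsm : ContDiff ℝ ∞ (fun t => flatExp a (t + c)) :=
    (contDiff_flatExp a).comp (contDiff_id.add contDiff_const)
  have heq : (fun x => flatExp a (l x + c)) = (fun t => flatExp a (t + c)) ∘ l := rfl
  refine ⟨hsm.comp l.contDiff, fun K _ A hA => ?_⟩
  -- The chain rule costs `‖l‖ ^ n`, absorbed into the parameter; adding `1` keeps it positive when
  -- `l = 0`.
  obtain ⟨C, hC0, hC⟩ := exists_flatExp_gevrey_bound (s := s) ha has
    (A := A * (‖l‖ + 1)) (by positivity)
  refine (ultraNorm_lt_top_iff hA).mpr ⟨C, hC0, fun n x _ => ?_⟩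
  refine le_trans ?_ (hC n (l x + c))
  have h1 : ‖iteratedFDeriv ℝ n (fun x => flatExp a (l x + c)) x‖ ≤
      ‖iteratedDeriv n (flatExp a) (l x + c)‖ * ‖l‖ ^ n := by
    rw [heq, ContinuousLinearMap.iteratedFDeriv_comp_right _ hsm _ (by exact_mod_cast le_top)]
    refine (ContinuousMultilinearMap.norm_compContinuousLinearMap_le _ _).trans ?_
    rw [norm_iteratedFDeriv_eq_norm_iteratedDeriv, iteratedDeriv_comp_add_const]
    simp
  have h2 : ‖l‖ ^ n ≤ (‖l‖ + 1) ^ n := pow_le_pow_left₀ (norm_nonneg _) (by linarith) n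
  rw [mul_pow]
  calc A ^ n / (n.factorial : ℝ) ^ s * ‖iteratedFDeriv ℝ n (fun x => flatExp a (l x + c)) x‖
      ≤ A ^ n / (n.factorial : ℝ) ^ s *
        (‖iteratedDeriv n (flatExp a) (l x + c)‖ * (‖l‖ + 1) ^ n) :=
        mul_le_mul_of_nonneg_left (h1.trans (mul_le_mul_of_nonneg_left h2 (norm_nonneg _)))
          (by positivity)
    _ = _ := by ring

theorem prod_mem_EBeurling {d : ℕ} {s : ℝ} (hs : 1 < s) {ι : Type*} (S : Finset ι)
    {g : ι → Rd d → ℂ} (hg : ∀ i ∈ S, g i ∈ EBeurling d s) : ∏ i ∈ S, g i ∈ EBeurling d s := by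
  refine Finset.prod_induction g (· ∈ EBeurling d s) (fun _ _ => mul_mem_EBeurling hs) ?_ hg
  -- The empty product is the constant `1`, which is the exponential of frequency `0`.
  convert expFun_mem (d := d) hs 0 using 1
  funext x
  simp [expFun]

/-- Cut-off functions in `𝒟^{(s)}`. -/
theorem exists_cutoff {d : ℕ} {s : ℝ} (hs : 1 < s) {U : Set (Rd d)} (hU : IsOpen U) {x₀ : Rd d}
    (hx₀ : x₀ ∈ U) : ∃ χ ∈ DBeurling s U, ∀ᶠ x in 𝓝 x₀, χ x = 1 := by
  obtain ⟨r, hr, hrU⟩ := Metric.nhds_basis_closedBall.mem_iff.mp (hU.mem_nhds hx₀)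
  -- The cube of half-side `ρ` lies in the ball of radius `r`, since `d * ρ ^ 2 ≤ r ^ 2`; the `+ 1`
  -- also covers `d = 0`.
  set ρ := r / (d + 1) with hρ
  have hρ0 : 0 < ρ := by positivity
  obtain ⟨a, ha, has⟩ : ∃ a : ℕ, Odd a ∧ 1 < (s - 1) * a := by
    obtain ⟨m, hm⟩ := exists_nat_gt (1 / (s - 1))
    have hs1 : 0 < s - 1 := by linarith
    rw [div_lt_iff₀ hs1] at hm
    refine ⟨2 * m + 1, ⟨m, rfl⟩, ?_⟩
    push_cast
    nlinarith [(Nat.cast_nonneg m : (0 : ℝ) ≤ m)]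
  set η : ℝ → ℝ := fun t => expNegInvGlue (t ^ a) with hη
  have hη0 : ∀ t, 0 ≤ η t := fun t => expNegInvGlue.nonneg _
  have hηpos : ∀ t, 0 < t → 0 < η t := fun t ht => expNegInvGlue.pos_of_pos (pow_pos ht a)
  have hηzero : ∀ t, t ≤ 0 → η t = 0 := fun t ht => expNegInvGlue.zero_of_nonpos (ha.pow_nonpos ht)
  have hmem : ∀ (σ : ℝ) (i : Fin d) (c : ℝ),
      (fun x : Rd d => ((η (σ * (x i - x₀ i) + c) : ℝ) : ℂ)) ∈ EBeurling d s := by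
    intro σ i c
    have := flatExp_comp_mem_EBeurling (d := d) (s := s) ha has
      (σ • (EuclideanSpace.proj i : Rd d →L[ℝ] ℝ)) (c - σ * x₀ i)
    convert this using 3 with x
    simp only [flatExp, hη]
    congr 3
    simp
    ring
  -- `b` is positive exactly on the open cube of half-side `ρ`, while `b'` vanishes exactly on the
  -- closed cube of half-side `ρ / 2`. Thus `b + b'` has no zero and `b / (b + b')` is the cut-off.
  set b : Rd d → ℝ := fun x => ∏ i, (η (1 * (x i - x₀ i) + ρ) * η (-1 * (x i - x₀ i) + ρ)) with hb
  set b' : Rd d → ℝ := fun x =>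
    ∑ i, (η (1 * (x i - x₀ i) + -(ρ / 2)) + η (-1 * (x i - x₀ i) + -(ρ / 2))) with hb'
  have hbmem : (fun x => (b x : ℂ)) ∈ EBeurling d s := by
    have := prod_mem_EBeurling hs Finset.univ (g := fun i =>
      (fun x : Rd d => ((η (1 * (x i - x₀ i) + ρ) : ℝ) : ℂ)) *
        fun x : Rd d => ((η (-1 * (x i - x₀ i) + ρ) : ℝ) : ℂ))
      (fun i _ => mul_mem_EBeurling hs (hmem 1 i ρ) (hmem (-1) i ρ))
    convert this using 1
    funext x
    simp [hb]
  have hb'mem : (fun x => (b' x : ℂ)) ∈ EBeurling d s := by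
    have := Submodule.sum_mem (EBeurling d s) (t := Finset.univ) (f := fun i =>
      (fun x : Rd d => ((η (1 * (x i - x₀ i) + -(ρ / 2)) : ℝ) : ℂ)) +
        fun x : Rd d => ((η (-1 * (x i - x₀ i) + -(ρ / 2)) : ℝ) : ℂ))
      (fun i _ => Submodule.add_mem _ (hmem 1 i _) (hmem (-1) i _))
    convert this using 1
    funext x
    simp [hb']
  have hb0 : ∀ x, 0 ≤ b x := fun x => Finset.prod_nonneg fun i _ => mul_nonneg (hη0 _) (hη0 _)
  have hb'0 : ∀ x, 0 ≤ b' x := fun x => Finset.sum_nonneg fun i _ => add_nonneg (hη0 _) (hη0 _)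
  have hbpos : ∀ x, (∀ i, |x i - x₀ i| < ρ) → 0 < b x := by
    intro x hx
    refine Finset.prod_pos fun i _ => mul_pos (hηpos _ ?_) (hηpos _ ?_)
    · linarith [(abs_lt.mp (hx i)).1]
    · linarith [(abs_lt.mp (hx i)).2]
  have hbzero : ∀ x i, ρ ≤ |x i - x₀ i| → b x = 0 := by
    intro x i hi
    refine Finset.prod_eq_zero (Finset.mem_univ i) ?_
    rcases le_abs.mp hi with h | h
    · rw [hηzero (-1 * (x i - x₀ i) + ρ) (by linarith), mul_zero]
    · rw [hηzero (1 * (x i - x₀ i) + ρ) (by linarith), zero_mul]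
  have hpos : ∀ x, 0 < b x + b' x := by
    intro x
    by_cases h : ∀ i, |x i - x₀ i| < ρ
    · exact add_pos_of_pos_of_nonneg (hbpos x h) (hb'0 x)
    · push Not at h
      obtain ⟨i, hi⟩ := h
      refine add_pos_of_nonneg_of_pos (hb0 x)
        (Finset.sum_pos' (fun i _ => add_nonneg (hη0 _) (hη0 _)) ⟨i, Finset.mem_univ i, ?_⟩)
      rcases le_abs.mp hi with h | h
      · exact add_pos_of_pos_of_nonneg (hηpos _ (by linarith)) (hη0 _)
      · exact add_pos_of_nonneg_of_pos (hη0 _) (hηpos _ (by linarith))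
  have hsupp : tsupport (fun x => (b x : ℂ)) ⊆ Metric.closedBall x₀ r := by
    refine closure_minimal (fun x hx => ?_) Metric.isClosed_closedBall
    have hall : ∀ i, |x i - x₀ i| < ρ := by
      intro i
      by_contra hi
      exact hx (by simp [hbzero x i (not_lt.mp hi)])
    rw [mem_closedBall_iff_norm, EuclideanSpace.norm_eq, Real.sqrt_le_left hr.le]
    calc ∑ i, ‖(x - x₀) i‖ ^ 2 ≤ ∑ _i : Fin d, ρ ^ 2 := by
          refine Finset.sum_le_sum fun i _ => pow_le_pow_left₀ (norm_nonneg _) ?_ 2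
          simpa using (hall i).le
      _ = d * ρ ^ 2 := by simp
      _ ≤ r ^ 2 := by
          have h1 : r = ρ * (d + 1) := by
            rw [hρ]
            field_simp
          have h2 : (0 : ℝ) ≤ d := Nat.cast_nonneg d
          rw [h1, mul_pow, mul_comm]
          refine mul_le_mul_of_nonneg_left ?_ (by positivity)
          nlinarith
  have hD : (fun x => (b x : ℂ)) ∈ DBeurling s U :=
    ⟨hbmem, (isCompact_closedBall x₀ r).of_isClosed_subset (isClosed_tsupport _) hsupp,
      hsupp.trans hrU⟩
  refine ⟨_, mul_inv_mem_DBeurling hs hD (Submodule.add_mem _ hbmem hb'mem) (fun x _ => ?_), ?_⟩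
  · have := (hpos x).ne'
    simp only [Pi.add_apply]
    exact_mod_cast this
  · filter_upwards [Metric.ball_mem_nhds x₀ (half_pos hρ0)] with x hx
    have hlt : ∀ i, |x i - x₀ i| < ρ / 2 := by
      intro i
      refine lt_of_le_of_lt ?_ (mem_ball_iff_norm.mp hx)
      simpa using PiLp.norm_apply_le (x - x₀) i
    have h1 : b' x = 0 := by
      refine Finset.sum_eq_zero fun i _ => ?_
      rw [hηzero _ (by linarith [(abs_lt.mp (hlt i)).2]),
        hηzero _ (by linarith [(abs_lt.mp (hlt i)).1]), add_zero]
    have h2 : (b x : ℂ) ≠ 0 := by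
      exact_mod_cast (hbpos x fun i => (hlt i).trans (by linarith)).ne'
    simp [h1, h2]

/-! ### Gevrey norms of exponentials -/

theorem gevrey_mul_pow_le {s A t : ℝ} (hs : 0 < s) (hA : 0 < A) (ht : 0 ≤ t) (n : ℕ) :
    A ^ n / (n.factorial : ℝ) ^ s * t ^ n ≤ Real.exp (s * A ^ (1 / s) * t ^ (1 / s)) := by
  have h := pow_le_factorial_rpow_mul_exp hs (mul_nonneg hA.le ht) n
  rw [Real.mul_rpow hA.le ht, mul_pow, ← mul_assoc s] at h
  have hp : (0 : ℝ) < (n.factorial : ℝ) ^ s := Real.rpow_pos_of_pos (by positivity) s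
  rw [div_mul_eq_mul_div, div_le_iff₀ hp]
  linarith

/-- The growth rate `|ξ|^{1/s}` is sharper than the linear rate used for membership in `expFun_mem`,
and it matches the weights; it bounds Fourier transforms of compactly supported ultradistributions.
-/
theorem ultraNorm_expFun_le {d : ℕ} {s A : ℝ} (hs : 0 < s) (hA : 0 < A) (K : Set (Rd d)) (ξ : Rd d) :
    ultraNorm s A K (expFun ξ) ≤
      ENNReal.ofReal (Real.exp (s * A ^ (1 / s) * ‖ξ‖ ^ (1 / s))) := by
  refine iSup_le fun n => iSup₂_le fun x _ => ?_
  rw [← ofReal_norm, ← ENNReal.ofReal_mul (by positivity)]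
  refine ENNReal.ofReal_le_ofReal ((mul_le_mul_of_nonneg_left
    (norm_iteratedFDeriv_expFun_le ξ n x) (by positivity)).trans ?_)
  exact gevrey_mul_pow_le hs hA (norm_nonneg ξ) n

/-- Order zero is controlled by boundedness of `K`; every derivative of positive order carries a
factor `‖δ‖ ^ n ≤ ‖δ‖`. Multiplication by a fixed exponential turns this into continuity at every
frequency. -/
theorem exists_ultraNorm_expFun_sub_one_le {d : ℕ} {s A : ℝ} (hs : 1 < s) (hA : 0 < A)
    {K : Set (Rd d)} (hK : IsCompact K) :
    ∃ M : ℝ, 0 ≤ M ∧ ∀ δ : Rd d, ‖δ‖ ≤ 1 →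
      ultraNorm s A K (expFun δ - 1) ≤ ENNReal.ofReal (M * ‖δ‖) := by
  obtain ⟨R, hR⟩ := hK.isBounded.exists_norm_le
  refine ⟨max R (A * Real.exp A), le_max_of_le_right (by positivity), fun δ hδ => ?_⟩
  refine iSup_le fun n => iSup₂_le fun x hx => ?_
  rw [← ofReal_norm, ← ENNReal.ofReal_mul (by positivity)]
  refine ENNReal.ofReal_le_ofReal ?_
  rcases n with _ | n
  · have h1 : ‖expFun δ x - 1‖ ≤ ‖x‖ * ‖δ‖ := by
      have h2 := Real.norm_exp_I_mul_ofReal_sub_one_le (x := -(inner ℝ x δ : ℝ))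
      have h3 : expFun δ x = Complex.exp (Complex.I * ((-(inner ℝ x δ : ℝ) : ℝ) : ℂ)) := by
        simp [expFun]
      rw [h3]
      refine h2.trans ?_
      rw [norm_neg]
      exact norm_inner_le_norm x δ
    rw [norm_iteratedFDeriv_zero]
    simp only [pow_zero, Nat.factorial_zero, Nat.cast_one, Real.one_rpow, div_one, one_mul,
      Pi.sub_apply, Pi.one_apply]
    exact h1.trans (mul_le_mul_of_nonneg_right ((hR x hx).trans (le_max_left _ _)) (norm_nonneg _))
  · have hD : iteratedFDeriv ℝ (n + 1) (expFun δ - 1) x = iteratedFDeriv ℝ (n + 1) (expFun δ) x := by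
      have h1 : (expFun δ - 1 : Rd d → ℂ) = expFun δ - fun _ => 1 := rfl
      rw [h1, iteratedFDeriv_sub_apply
        (((contDiff_expFun δ).of_le (by exact_mod_cast le_top)).contDiffAt)
        contDiff_const.contDiffAt, iteratedFDeriv_const_of_ne (Nat.succ_ne_zero n)]
      simp
    rw [hD]
    have hf1 : (1 : ℝ) ≤ ((n + 1).factorial : ℝ) := by
      exact_mod_cast Nat.one_le_iff_ne_zero.mpr (Nat.factorial_ne_zero _)
    have hf2 : (n.factorial : ℝ) ≤ ((n + 1).factorial : ℝ) ^ s :=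
      (by exact_mod_cast Nat.factorial_le (Nat.le_succ n) :
        (n.factorial : ℝ) ≤ ((n + 1).factorial : ℝ)).trans (Real.self_le_rpow_of_one_le hf1 hs.le)
    have hn0 : (0 : ℝ) < n.factorial := by positivity
    have h1 : A ^ (n + 1) / ((n + 1).factorial : ℝ) ^ s ≤ A * Real.exp A := by
      calc A ^ (n + 1) / ((n + 1).factorial : ℝ) ^ s ≤ A ^ (n + 1) / n.factorial :=
            div_le_div_of_nonneg_left (by positivity) hn0 hf2
        _ = A * (A ^ n / n.factorial) := by ring
        _ ≤ A * Real.exp A :=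
            mul_le_mul_of_nonneg_left (Real.pow_div_factorial_le_exp _ hA.le n) hA.le
    have h2 : ‖iteratedFDeriv ℝ (n + 1) (expFun δ) x‖ ≤ ‖δ‖ :=
      (norm_iteratedFDeriv_expFun_le δ (n + 1) x).trans
        (pow_le_of_le_one (norm_nonneg _) hδ (Nat.succ_ne_zero n))
    calc _ ≤ A * Real.exp A * ‖δ‖ :=
          mul_le_mul h1 h2 (norm_nonneg _) (by positivity)
      _ ≤ _ := mul_le_mul_of_nonneg_right (le_max_right _ _) (norm_nonneg _)

theorem iteratedFDeriv_expFun_apply {d : ℕ} (ξ : Rd d) (n : ℕ) (x : Rd d) (v : Fin n → Rd d) :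
    iteratedFDeriv ℝ n (expFun ξ) x v =
      (-Complex.I) ^ n * (∏ i, ((inner ℝ ξ (v i) : ℝ) : ℂ)) * expFun ξ x := by
  have hder : ∀ t : ℝ, HasDerivAt (fun t : ℝ => Complex.exp (-(Complex.I * (t : ℂ))))
      (-Complex.I * Complex.exp (-(Complex.I * (t : ℂ)))) t := by
    intro t
    have h1 : HasDerivAt (fun t : ℝ => -(Complex.I * (t : ℂ))) (-(Complex.I * 1)) t :=
      ((Complex.ofRealCLM.hasDerivAt (x := t)).const_mul Complex.I).neg
    convert h1.cexp using 1
    ring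
  have hit : ∀ m : ℕ, iteratedDeriv m (fun t : ℝ => Complex.exp (-(Complex.I * (t : ℂ)))) =
      fun t : ℝ => (-Complex.I) ^ m * Complex.exp (-(Complex.I * (t : ℂ))) := by
    intro m
    induction m with
    | zero => simp
    | succ m ih =>
      rw [iteratedDeriv_succ, ih]
      funext t
      rw [((hder t).const_mul _).deriv]
      ring
  have hsm : ContDiff ℝ ∞ (fun t : ℝ => Complex.exp (-(Complex.I * (t : ℂ)))) :=
    ContDiff.cexp (ContDiff.neg (contDiff_const.mul Complex.ofRealCLM.contDiff))
  have hcomp : expFun ξ = (fun t : ℝ => Complex.exp (-(Complex.I * (t : ℂ)))) ∘ (innerSL ℝ ξ) := by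
    funext y
    simp [expFun, real_inner_comm]
  rw [hcomp, ContinuousLinearMap.iteratedFDeriv_comp_right _ hsm _ (by exact_mod_cast le_top),
    ContinuousMultilinearMap.compContinuousLinearMap_apply,
    iteratedFDeriv_apply_eq_iteratedDeriv_mul_prod, hit]
  simp only [innerSL_apply_apply, Function.comp_apply, Complex.real_smul, Complex.ofReal_prod]
  ring

/-! ### Jets and extension of functionals -/

/-- Hahn–Banach: a functional dominated by the norm of a linear map factors through it. -/
theorem exists_continuousLinearMap_comp_eq {V W : Type*} [AddCommGroup V] [Module ℂ V]
    [NormedAddCommGroup W] [NormedSpace ℂ W] (J : V →ₗ[ℂ] W) (u : V →ₗ[ℂ] ℂ) (C : ℝ)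
    (h : ∀ g, ‖u g‖ ≤ C * ‖J g‖) : ∃ T : W →L[ℂ] ℂ, ∀ g, T (J g) = u g := by
  have hker : LinearMap.ker J ≤ LinearMap.ker u := by
    intro g hg
    have := h g
    rw [LinearMap.mem_ker.mp hg, norm_zero, mul_zero] at this
    exact LinearMap.mem_ker.mpr (norm_le_zero_iff.mp this)
  set u₀ : LinearMap.range J →ₗ[ℂ] ℂ :=
    ((LinearMap.ker J).liftQ u hker) ∘ₗ (J.quotKerEquivRange.symm : _ →ₗ[ℂ] _) with hu₀
  have hu : ∀ g, u₀ ⟨J g, LinearMap.mem_range_self J g⟩ = u g := by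
    intro g
    have : (⟨J g, LinearMap.mem_range_self J g⟩ : LinearMap.range J) =
        J.quotKerEquivRange ((LinearMap.ker J).mkQ g) := rfl
    rw [this]
    simp [hu₀]
  obtain ⟨T, hT, -⟩ := exists_extension_norm_eq (LinearMap.range J) (u₀.mkContinuous C (by
    rintro ⟨_, g, rfl⟩
    rw [hu]
    exact h g))
  refine ⟨T, fun g => ?_⟩
  have := hT ⟨J g, LinearMap.mem_range_self J g⟩
  rw [LinearMap.mkContinuous_apply, hu] at this
  exact this

/-- The Banach space of bounded families of multilinear maps which receives the normalized jets of
functions at the points of `K`. -/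
abbrev JetSpace {d : ℕ} (K : Set (Rd d)) : Type :=
  lp (fun i : ℕ × K => ContinuousMultilinearMap ℝ (fun _ : Fin i.1 => Rd d) ℂ) ∞

/-- The normalized jet of a function in `ℰ^{(s)}`. -/
def jet {d : ℕ} {s A : ℝ} (hA : 0 < A) {K : Set (Rd d)} (hK : IsCompact K) :
    EBeurling d s →ₗ[ℂ] JetSpace K where
  toFun g := ⟨fun i => (((A ^ i.1 / (i.1.factorial : ℝ) ^ s : ℝ)) : ℂ) •
      iteratedFDeriv ℝ i.1 (g : Rd d → ℂ) i.2, by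
    obtain ⟨C, -, hC⟩ := (ultraNorm_lt_top_iff hA).mp (g.2.2 K hK A hA)
    refine memℓp_infty ⟨C, ?_⟩
    rintro _ ⟨i, rfl⟩
    dsimp only
    rw [norm_smul, Complex.norm_real, Real.norm_of_nonneg (by positivity)]
    exact hC i.1 i.2 i.2.2⟩
  map_add' g h := by
    ext i : 2
    simp only [lp.coeFn_add, Pi.add_apply, Submodule.coe_add]
    rw [iteratedFDeriv_add_apply ((g.2.1.of_le (by exact_mod_cast le_top)).contDiffAt)
      ((h.2.1.of_le (by exact_mod_cast le_top)).contDiffAt), smul_add]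
  map_smul' c g := by
    ext i : 2
    simp only [lp.coeFn_smul, Pi.smul_apply, Submodule.coe_smul, RingHom.id_apply]
    rw [iteratedFDeriv_const_smul_apply ((g.2.1.of_le (by exact_mod_cast le_top)).contDiffAt),
      smul_comm]

theorem jet_apply {d : ℕ} {s A : ℝ} (hA : 0 < A) {K : Set (Rd d)} (hK : IsCompact K)
    (g : EBeurling d s) (i : ℕ × K) :
    jet hA hK g i = (((A ^ i.1 / (i.1.factorial : ℝ) ^ s : ℝ)) : ℂ) •
      iteratedFDeriv ℝ i.1 (g : Rd d → ℂ) i.2 := rfl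

theorem norm_jet_apply {d : ℕ} {s A : ℝ} (hA : 0 < A) {K : Set (Rd d)} (hK : IsCompact K)
    (g : EBeurling d s) (i : ℕ × K) :
    ‖jet hA hK g i‖ = A ^ i.1 / (i.1.factorial : ℝ) ^ s * ‖iteratedFDeriv ℝ i.1 (g : Rd d → ℂ) i.2‖ := by
  rw [jet_apply, norm_smul, Complex.norm_real, Real.norm_of_nonneg (by positivity)]

/-- The normalization of the jet makes its supremum norm the Gevrey norm, so the continuity bound of
a functional is exactly the hypothesis needed for Hahn–Banach. -/
theorem enorm_jet {d : ℕ} {s A : ℝ} (hA : 0 < A) {K : Set (Rd d)} (hK : IsCompact K)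
    (g : EBeurling d s) : ‖jet hA hK g‖ₑ = ultraNorm s A K g := by
  have hfin := (g.2.2 K hK A hA).ne
  refine le_antisymm ?_ (iSup_le fun n => iSup₂_le fun x hx => ?_)
  · rw [← ofReal_norm, ENNReal.ofReal_le_iff_le_toReal hfin]
    refine lp.norm_le_of_forall_le ENNReal.toReal_nonneg fun i => ?_
    have := ENNReal.toReal_mono hfin (le_ultraNorm s A (g : Rd d → ℂ) i.1 i.2.2)
    rw [ENNReal.toReal_mul, ENNReal.toReal_ofReal (by positivity), toReal_enorm] at this
    rwa [norm_jet_apply]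
  · rw [← ofReal_norm, ← ofReal_norm, ← ENNReal.ofReal_mul (by positivity)]
    refine ENNReal.ofReal_le_ofReal ?_
    have := lp.norm_apply_le_norm ENNReal.top_ne_zero (jet hA hK g) (n, ⟨x, hx⟩)
    rwa [norm_jet_apply] at this

/-- Supplies the strong measurability required for Bochner integrals in the jet space, as well as
the continuity of Fourier transforms. -/
theorem continuous_jet_expFun {d : ℕ} {s A : ℝ} (hs : 1 < s) (hA : 0 < A) {K : Set (Rd d)}
    (hK : IsCompact K) :
    Continuous fun ξ : Rd d => jet hA hK (⟨expFun ξ, expFun_mem hs ξ⟩ : EBeurling d s) := by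
  obtain ⟨M, hM0, hM⟩ := exists_ultraNorm_expFun_sub_one_le hs (show 0 < 2 * A by positivity) hK
  rw [continuous_iff_continuousAt]
  intro η
  set X := Real.exp (s * (2 * A) ^ (1 / s) * ‖η‖ ^ (1 / s)) with hX
  have hlim : Tendsto (fun ξ : Rd d => X * (M * ‖ξ - η‖)) (𝓝 η) (𝓝 0) := by
    have : Continuous fun ξ : Rd d => X * (M * ‖ξ - η‖) := by fun_prop
    simpa using this.tendsto η
  refine tendsto_iff_norm_sub_tendsto_zero.mpr
    (squeeze_zero' (Eventually.of_forall fun _ => norm_nonneg _) ?_ hlim)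
  filter_upwards [Metric.closedBall_mem_nhds η one_pos] with ξ hξ
  have hδ : ‖ξ - η‖ ≤ 1 := mem_closedBall_iff_norm.mp hξ
  -- Factoring out `expFun η` reduces continuity at `η` to the estimate at frequency `0`; the
  -- product estimate accounts for `2 * A`.
  have hmul : expFun ξ - expFun η = expFun η * (expFun (ξ - η) - 1) := by
    funext x
    simp only [expFun, Pi.sub_apply, Pi.mul_apply, Pi.one_apply, mul_sub, mul_one, ← Complex.exp_add]
    congr 2
    rw [inner_sub_right]
    push_cast
    ring
  have h1 : ultraNorm s A K (expFun ξ - expFun η) ≤ ENNReal.ofReal (X * (M * ‖ξ - η‖)) := by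
    rw [hmul, ENNReal.ofReal_mul (by positivity)]
    refine (ultraNorm_mul_le hs hA K (contDiff_expFun η)
      ((contDiff_expFun _).sub contDiff_const)).trans ?_
    exact mul_le_mul' (ultraNorm_expFun_le (by linarith) (by positivity) K η) (hM _ hδ)
  rw [← map_sub, ← ENNReal.ofReal_le_ofReal_iff (by positivity), ofReal_norm, enorm_jet]
  exact h1

/-- Factorization of a compactly supported ultradistribution through the jet map. -/
theorem CompactUltradistribution.exists_jet_factorization {d : ℕ} {s : ℝ}
    (u : CompactUltradistribution d s) :
    ∃ (K : Set (Rd d)) (hK : IsCompact K) (A : ℝ) (hA : 0 < A) (T : JetSpace K →L[ℂ] ℂ),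
      ∀ g, u.toLinearMap g = T (jet hA hK g) := by
  obtain ⟨K, hK, A, hA, C, hC⟩ := u.continuous'
  obtain ⟨T, hT⟩ := exists_continuousLinearMap_comp_eq (jet hA hK) u.toLinearMap C (fun g => by
    have := hC g
    rw [← enorm_jet hA hK] at this
    have h2 := ENNReal.toReal_mono (by finiteness) this
    simpa using h2)
  exact ⟨K, hK, A, hA, T, fun g => (hT g).symm⟩

theorem CompactUltradistribution.continuous_apply_expFun {d : ℕ} {s : ℝ} (hs : 1 < s)
    (u : CompactUltradistribution d s) :
    Continuous fun ξ : Rd d => u.toLinearMap ⟨expFun ξ, expFun_mem hs ξ⟩ := by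
  obtain ⟨K, hK, A, hA, T, hT⟩ := u.exists_jet_factorization
  simp only [hT]
  exact T.continuous.comp (continuous_jet_expFun hs hA hK)

theorem CompactUltradistribution.exists_norm_apply_expFun_le {d : ℕ} {s : ℝ} (hs : 1 < s)
    (u : CompactUltradistribution d s) :
    ∃ C r : ℝ, 0 ≤ C ∧ 0 ≤ r ∧ ∀ ξ : Rd d,
      ‖u.toLinearMap ⟨expFun ξ, expFun_mem hs ξ⟩‖ ≤ C * Real.exp (r * ‖ξ‖ ^ (1 / s)) := by
  obtain ⟨K, hK, A, hA, C, hC⟩ := u.continuous'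
  refine ⟨C, s * A ^ (1 / s), C.2, by positivity, fun ξ => ?_⟩
  have h1 := (hC ⟨expFun ξ, expFun_mem hs ξ⟩).trans
    (mul_le_mul_right (ultraNorm_expFun_le (by linarith) hA K ξ) _)
  have h2 := ENNReal.toReal_mono (by finiteness) h1
  rwa [ENNReal.toReal_mul, ENNReal.toReal_ofReal (by positivity), toReal_enorm] at h2

/-! ### Functionals under Fourier integrals -/

theorem iteratedFDeriv_fourier_eq_integral {d : ℕ} (h : SchwartzMap (Rd d) ℂ) (n : ℕ) (x : Rd d) :
    iteratedFDeriv ℝ n (𝓕 (h : Rd d → ℂ)) x =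
      ∫ w, h w • iteratedFDeriv ℝ n (expFun ((2 * Real.pi) • w)) x := by
  rw [Real.iteratedFDeriv_fourier (N := ⊤) (fun n _ => h.integrable_pow_mul volume n)
    h.continuous.aestronglyMeasurable le_top, Real.fourier_eq']
  congr 1
  funext w
  ext v
  simp only [smul_apply, VectorFourier.fourierPowSMulRight_apply,
    iteratedFDeriv_expFun_apply]
  -- The factor `2π` reconciles the kernel `e^{-2πi⟨w,x⟩}` of `𝓕` with the exponentials
  -- `e^{-i⟨x,ξ⟩}`.
  have h1 : expFun ((2 * Real.pi) • w) x =
      Complex.exp ((((-2 * Real.pi * inner ℝ w x : ℝ)) : ℂ) * Complex.I) := by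
    simp only [expFun, inner_smul_right, real_inner_comm]
    congr 1
    push_cast
    ring
  rw [h1]
  simp only [inner_smul_left, smul_eq_mul, Complex.real_smul, Complex.ofReal_prod,
    Complex.ofReal_mul, Finset.prod_mul_distrib, Finset.prod_const, Finset.card_univ,
    Fintype.card_fin, conj_trivial]
  have h2 : ∏ i, (((innerSL ℝ w) (v i) : ℝ) : ℂ) = ∏ i, ((inner ℝ w (v i) : ℝ) : ℂ) := rfl
  rw [h2, neg_pow, neg_pow Complex.I, mul_pow, mul_pow]
  push_cast
  ring

/-- A compactly supported ultradistribution may be applied under the integral sign of a Fourier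
integral. -/
theorem CompactUltradistribution.apply_fourier {d : ℕ} {s : ℝ} (hs : 1 < s)
    (u : CompactUltradistribution d s) (h : SchwartzMap (Rd d) ℂ)
    (hint : ∀ r : ℝ, Integrable fun w : Rd d => ‖h w‖ * Real.exp (r * ‖w‖ ^ (1 / s)))
    (G : EBeurling d s) (hG : (G : Rd d → ℂ) = 𝓕 (h : Rd d → ℂ)) :
    u.toLinearMap G =
      ∫ w, h w * u.toLinearMap ⟨expFun ((2 * Real.pi) • w), expFun_mem hs _⟩ := by
  obtain ⟨K, hK, A, hA, T, hT⟩ := u.exists_jet_factorization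
  set F : Rd d → JetSpace K := fun w =>
    h w • jet hA hK ⟨expFun ((2 * Real.pi) • w), expFun_mem hs _⟩ with hF
  have hFc : Continuous F := h.continuous.smul
    ((continuous_jet_expFun hs hA hK).comp (continuous_const_smul (2 * Real.pi)))
  have hFint : Integrable F := by
    refine (hint (s * A ^ (1 / s) * (2 * Real.pi) ^ (1 / s))).mono' hFc.aestronglyMeasurable
      (Eventually.of_forall fun w => ?_)
    rw [hF]
    simp only [norm_smul]
    refine mul_le_mul_of_nonneg_left ?_ (norm_nonneg _)
    rw [← ENNReal.ofReal_le_ofReal_iff (by positivity), ofReal_norm, enorm_jet]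
    refine (ultraNorm_expFun_le (by linarith) hA K _).trans (le_of_eq ?_)
    rw [norm_smul, Real.norm_of_nonneg (by positivity), Real.mul_rpow (by positivity) (by positivity)]
    congr 2
    ring
  -- Each coordinate of the jet space is a continuous linear map, so the Bochner integral can be
  -- identified coordinate by coordinate.
  have hjet : jet hA hK G = ∫ w, F w := by
    ext i : 2
    have h1 : (∫ w, F w) i = ∫ w, F w i :=
      ((lp.evalCLM ℂ (fun i : ℕ × K => ContinuousMultilinearMap ℝ (fun _ : Fin i.1 => Rd d) ℂ)
        ∞ i).integral_comp_comm hFint).symm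
    rw [h1, jet_apply, hG, iteratedFDeriv_fourier_eq_integral, ← integral_smul]
    congr 1
    funext w
    simp only [hF, lp.coeFn_smul, Pi.smul_apply, jet_apply]
    rw [smul_comm]
  rw [hT, hjet, ← T.integral_comp_comm hFint]
  congr 1
  funext w
  simp only [hF, map_smul, smul_eq_mul, hT]

/-! ### Paley–Wiener estimates and integrability of stretched exponentials -/

/-- Factorial moment bounds of Gevrey type yield stretched exponential decay. -/
theorem le_exp_of_forall_pow_mul_le {s t z B : ℝ} (hs : 0 < s) (ht : 0 ≤ t) (hz : 0 ≤ z) (hB : 0 ≤ B)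
    (h : ∀ n : ℕ, t ^ n * z ≤ B * (n.factorial : ℝ) ^ s) :
    z ≤ 2 ^ s * B * Real.exp (-(s / 2 * t ^ (1 / s))) := by
  set τ := t ^ (1 / s) with hτ
  have hτ0 : 0 ≤ τ := Real.rpow_nonneg ht _
  set y := z ^ (1 / s) with hy
  have hy0 : 0 ≤ y := Real.rpow_nonneg hz _
  -- Taking `s`-th roots turns `(n!) ^ s` into `n!`, so the bounds can be summed to an exponential;
  -- using `τ / 2` instead of `τ` leaves a convergent geometric series on the right.
  have hroot : ∀ n : ℕ, (τ / 2) ^ n / (n.factorial : ℝ) * y ≤ B ^ (1 / s) * (1 / 2) ^ n := by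
    intro n
    have h1 := Real.rpow_le_rpow (by positivity) (h n) (show 0 ≤ 1 / s by positivity)
    rw [Real.mul_rpow (by positivity) hz, Real.mul_rpow hB (by positivity),
      ← Real.rpow_mul (by positivity), mul_one_div_cancel hs.ne', Real.rpow_one] at h1
    have h2 : (t ^ n) ^ (1 / s) = τ ^ n := by
      rw [hτ, ← Real.rpow_natCast, ← Real.rpow_natCast, ← Real.rpow_mul ht, ← Real.rpow_mul ht,
        mul_comm]
    rw [h2] at h1
    have hn0 : (0 : ℝ) < n.factorial := by positivity
    calc (τ / 2) ^ n / (n.factorial : ℝ) * y = (τ ^ n * y) / n.factorial * (1 / 2) ^ n := by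
          rw [div_eq_mul_one_div τ 2, mul_pow]
          ring
      _ ≤ _ := mul_le_mul_of_nonneg_right ((div_le_iff₀ hn0).mpr h1) (by positivity)
  have hsum : Real.exp (τ / 2) * y ≤ B ^ (1 / s) * 2 := by
    have h1 : HasSum (fun n : ℕ => (τ / 2) ^ n / (n.factorial : ℝ)) (Real.exp (τ / 2)) := by
      rw [Real.exp_eq_exp_ℝ]
      exact NormedSpace.expSeries_div_hasSum_exp (τ / 2)
    exact hasSum_le hroot (h1.mul_right y) (hasSum_geometric_two.mul_left _)
  have hfin := Real.rpow_le_rpow (by positivity) hsum hs.le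
  rw [Real.mul_rpow (by positivity) hy0, Real.mul_rpow (by positivity) (by positivity),
    ← Real.rpow_mul hB, ← Real.rpow_mul hz, one_div_mul_cancel hs.ne', Real.rpow_one, Real.rpow_one,
    ← Real.exp_mul] at hfin
  rw [Real.exp_neg, ← div_eq_mul_inv, le_div_iff₀ (Real.exp_pos _)]
  calc z * Real.exp (s / 2 * τ) = Real.exp (τ / 2 * s) * z := by
        rw [mul_comm]
        congr 2
        ring
    _ ≤ _ := hfin
    _ = _ := by ring

theorem pow_mul_norm_fourier_le {d : ℕ} {ψ : Rd d → ℂ} (hψ : ContDiff ℝ ∞ ψ)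
    (hc : HasCompactSupport ψ) (n : ℕ) (w : Rd d) :
    (2 * Real.pi * ‖w‖) ^ n * ‖𝓕 ψ w‖ ≤ ∫ x, ‖iteratedFDeriv ℝ n ψ x‖ := by
  have hint : ∀ n : ℕ, Integrable (iteratedFDeriv ℝ n ψ) := fun n =>
    (hψ.continuous_iteratedFDeriv (by exact_mod_cast le_top)).integrable_of_hasCompactSupport
      (hc.iteratedFDeriv n)
  have hF := congrFun (Real.fourier_iteratedFDeriv (N := ⊤) hψ (fun n _ => hint n)
    (n := n) le_top) w
  have hle : ‖𝓕 (iteratedFDeriv ℝ n ψ) w‖ ≤ ∫ x, ‖iteratedFDeriv ℝ n ψ x‖ :=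
    VectorFourier.norm_fourierIntegral_le_integral_norm _ _ _ _ _
  by_cases hw : w = 0
  · subst hw
    rcases n with _ | n
    · have h0 : ‖𝓕 ψ 0‖ ≤ ∫ x, ‖ψ x‖ := VectorFourier.norm_fourierIntegral_le_integral_norm _ _ _ _ _
      simpa using h0
    · simp only [norm_zero, mul_zero, ne_eq, Nat.succ_ne_zero, not_false_eq_true, zero_pow, zero_mul]
      positivity
  · have hw0 : 0 < ‖w‖ := norm_pos_iff.mpr hw
    -- Evaluating the multilinear transform on `n` copies of `w` produces `(2π‖w‖²)ⁿ`; one factor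
    -- `‖w‖ ^ n` is cancelled at the end, hence the separate case `w = 0`.
    have h1 : ‖𝓕 (iteratedFDeriv ℝ n ψ) w fun _ => w‖ ≤ ‖𝓕 (iteratedFDeriv ℝ n ψ) w‖ * ‖w‖ ^ n := by
      simpa using (𝓕 (iteratedFDeriv ℝ n ψ) w).le_opNorm fun _ => w
    have h2 : ‖𝓕 (iteratedFDeriv ℝ n ψ) w fun _ => w‖ = (2 * Real.pi * ‖w‖) ^ n * ‖𝓕 ψ w‖ * ‖w‖ ^ n := by
      have h3 : ∀ v : Rd d, (-innerSL ℝ : Rd d →L[ℝ] Rd d →L[ℝ] ℝ) v v = -(‖v‖ ^ 2) := by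
        intro v
        rw [neg_apply, neg_apply, innerSL_apply_apply,
          real_inner_self_eq_norm_sq]
      rw [hF, VectorFourier.fourierPowSMulRight_apply]
      simp only [h3, Finset.prod_const, Finset.card_univ, Fintype.card_fin, norm_smul, norm_pow,
        norm_neg, norm_mul, Complex.norm_I, Complex.norm_real, Real.norm_of_nonneg Real.pi_pos.le,
        mul_one, norm_norm, Complex.norm_ofNat]
      ring
    rw [h2] at h1
    exact (le_of_mul_le_mul_right h1 (by positivity)).trans hle

/-- The Paley–Wiener estimate for `𝒟^{(s)}`. -/
theorem exists_norm_fourier_le {d : ℕ} {s : ℝ} (hs : 1 < s) {X : Set (Rd d)} {ψ : Rd d → ℂ}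
    (hψ : ψ ∈ DBeurling s X) {N : ℝ} (hN : 0 < N) :
    ∃ C : ℝ, 0 ≤ C ∧ ∀ w, ‖𝓕 ψ w‖ ≤ C * Real.exp (-(N * ‖w‖ ^ (1 / s))) := by
  have hs0 : 0 < s := by linarith
  -- Solves `s / 2 * A ^ (1 / s) = N`. Every rate `N` is reached because Beurling norms are finite
  -- for all `A`.
  set A := (2 * N / s) ^ s with hA
  have hA0 : 0 < A := by positivity
  set K := tsupport ψ with hK
  have hKc : IsCompact K := hψ.2.1
  obtain ⟨C, hC0, hC⟩ := (ultraNorm_lt_top_iff hA0).mp (hψ.1.2 K hKc A hA0)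
  set B := C * volume.real K with hB
  have hB0 : 0 ≤ B := by positivity
  refine ⟨2 ^ s * B, by positivity, fun w => ?_⟩
  have hmain := le_exp_of_forall_pow_mul_le (s := s) (t := A * ‖w‖) (z := ‖𝓕 ψ w‖) (B := B) hs0
    (by positivity) (norm_nonneg _) hB0 (fun n => ?_)
  · have h1 : s / 2 * (A * ‖w‖) ^ (1 / s) = N * ‖w‖ ^ (1 / s) := by
      rw [Real.mul_rpow hA0.le (norm_nonneg _), hA, ← Real.rpow_mul (by positivity),
        mul_one_div_cancel hs0.ne', Real.rpow_one]
      field_simp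
    rwa [h1] at hmain
  · have hp : (0 : ℝ) < (n.factorial : ℝ) ^ s := Real.rpow_pos_of_pos (by positivity) s
    have hint : ∫ x, ‖iteratedFDeriv ℝ n ψ x‖ ≤ C * (n.factorial : ℝ) ^ s / A ^ n * volume.real K := by
      have h0 : ∫ x in K, ‖iteratedFDeriv ℝ n ψ x‖ = ∫ x, ‖iteratedFDeriv ℝ n ψ x‖ := by
        refine setIntegral_eq_integral_of_forall_compl_eq_zero fun x hx => ?_
        rw [norm_eq_zero]
        by_contra hne
        exact hx (support_iteratedFDeriv_subset n (𝕜 := ℝ) hne)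
      have h1 := norm_setIntegral_le_of_norm_le_const (μ := volume)
        (f := fun x => ‖iteratedFDeriv ℝ n ψ x‖) (s := K)
        (C := C * (n.factorial : ℝ) ^ s / A ^ n) hKc.measure_lt_top (fun x hx => by
          have := hC n x hx
          rw [norm_norm, le_div_iff₀ (by positivity)]
          rw [div_mul_eq_mul_div, div_le_iff₀ hp] at this
          linarith)
      rw [h0] at h1
      exact (Real.le_norm_self _).trans h1
    have hpow := (pow_mul_norm_fourier_le hψ.1.1 hψ.2.1 n w).trans hint
    have h2 : ‖w‖ ^ n ≤ (2 * Real.pi * ‖w‖) ^ n := by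
      refine pow_le_pow_left₀ (norm_nonneg _) ?_ n
      nlinarith [Real.pi_gt_three, norm_nonneg w]
    calc (A * ‖w‖) ^ n * ‖𝓕 ψ w‖ = A ^ n * (‖w‖ ^ n * ‖𝓕 ψ w‖) := by rw [mul_pow, mul_assoc]
      _ ≤ A ^ n * (C * (n.factorial : ℝ) ^ s / A ^ n * volume.real K) :=
        mul_le_mul_of_nonneg_left
          ((mul_le_mul_of_nonneg_right h2 (norm_nonneg _)).trans hpow) (by positivity)
      _ = B * (n.factorial : ℝ) ^ s := by
        rw [hB]
        field_simp

theorem continuous_exp_neg_norm_rpow {d : ℕ} {s : ℝ} (hs : 0 < s) (κ : ℝ) :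
    Continuous fun x : Rd d => Real.exp (-(κ * ‖x‖ ^ (1 / s))) :=
  Real.continuous_exp.comp ((continuous_const.mul
    (continuous_norm.rpow_const fun _ => Or.inr (by positivity))).neg)

/-- Comparison with `(1 + ‖x‖) ^ (-(d + 1))` through the factorial bound of order `d + 1`.
Subadditivity of `t ↦ t ^ (1 / s)`, valid for `s ≥ 1`, passes from `‖x‖` to `1 + ‖x‖`. -/
theorem integrable_exp_neg_norm_rpow {d : ℕ} {s : ℝ} (hs : 1 ≤ s) {κ : ℝ} (hκ : 0 < κ) :
    Integrable fun x : Rd d => Real.exp (-(κ * ‖x‖ ^ (1 / s))) := by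
  have hs0 : 0 < s := by linarith
  set c := (κ / s) ^ s with hc
  have hc0 : 0 < c := by positivity
  have hjap : Integrable (fun x : Rd d => (1 + ‖x‖) ^ (-((d + 1 : ℕ) : ℝ))) :=
    integrable_one_add_norm (by simp)
  refine (hjap.const_mul (((d + 1).factorial : ℝ) ^ s * Real.exp κ / c ^ (d + 1))).mono'
    (continuous_exp_neg_norm_rpow hs0 κ).aestronglyMeasurable (Eventually.of_forall fun x => ?_)
  have hx0 : 0 < 1 + ‖x‖ := by positivity
  have h1 := pow_le_factorial_rpow_mul_exp hs0 (t := c * (1 + ‖x‖)) (by positivity) (d + 1)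
  have h2 : s * (c * (1 + ‖x‖)) ^ (1 / s) = κ * (1 + ‖x‖) ^ (1 / s) := by
    rw [Real.mul_rpow hc0.le hx0.le, hc, ← Real.rpow_mul (by positivity),
      mul_one_div_cancel hs0.ne', Real.rpow_one]
    field_simp
  have h3 : (1 + ‖x‖) ^ (1 / s) ≤ 1 + ‖x‖ ^ (1 / s) := by
    have := Real.rpow_add_le_add_rpow zero_le_one (norm_nonneg x) (show 0 ≤ 1 / s by positivity)
      ((div_le_one hs0).mpr hs)
    simpa using this
  have h4 : Real.exp (κ * (1 + ‖x‖) ^ (1 / s)) ≤ Real.exp κ * Real.exp (κ * ‖x‖ ^ (1 / s)) := by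
    rw [← Real.exp_add]
    refine Real.exp_le_exp.mpr ?_
    nlinarith
  rw [h2, mul_pow] at h1
  rw [Real.norm_of_nonneg (Real.exp_pos _).le, Real.rpow_neg hx0.le, Real.rpow_natCast,
    ← div_eq_mul_inv, le_div_iff₀ (by positivity), le_div_iff₀ (by positivity), Real.exp_neg,
    mul_assoc, inv_mul_le_iff₀ (Real.exp_pos _)]
  calc (1 + ‖x‖) ^ (d + 1) * c ^ (d + 1) = c ^ (d + 1) * (1 + ‖x‖) ^ (d + 1) := mul_comm _ _
    _ ≤ _ := h1
    _ ≤ ((d + 1).factorial : ℝ) ^ s * (Real.exp κ * Real.exp (κ * ‖x‖ ^ (1 / s))) :=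
        mul_le_mul_of_nonneg_left h4 (by positivity)
    _ = _ := by ring

theorem memLp_exp_neg_norm_rpow {d : ℕ} {s : ℝ} (hs : 1 ≤ s) {κ : ℝ} (hκ : 0 < κ) {p : ℝ≥0∞}
    (hp : p ≠ 0) : MemLp (fun x : Rd d => Real.exp (-(κ * ‖x‖ ^ (1 / s)))) p volume := by
  have hmeas := (continuous_exp_neg_norm_rpow (d := d) (show 0 < s by linarith) κ).aestronglyMeasurable
    (μ := volume)
  by_cases htop : p = ⊤
  · subst htop
    refine memLp_top_of_bound hmeas 1 (Eventually.of_forall fun x => ?_)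
    rw [Real.norm_of_nonneg (Real.exp_pos _).le, Real.exp_le_one_iff]
    have : 0 ≤ κ * ‖x‖ ^ (1 / s) := by positivity
    linarith
  · rw [← integrable_norm_rpow_iff hmeas hp htop]
    have hp0 : 0 < p.toReal := ENNReal.toReal_pos hp htop
    convert integrable_exp_neg_norm_rpow (d := d) hs (mul_pos hκ hp0) using 2 with x
    rw [Real.norm_of_nonneg (Real.exp_pos _).le, ← Real.exp_mul]
    congr 1
    ring

/-! ### Convolution estimates in cones -/

/-- Every direction in an open cone `Γ` has an open conical neighbourhood which is well inside `Γ`. -/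
theorem IsOpenCone.exists_subcone {d : ℕ} {Γ : Set (Rd d)} (hΓ : IsOpenCone Γ) {ξ₀ : Rd d}
    (hξ₀ : ξ₀ ∈ Γ) :
    ∃ c : ℝ, 0 < c ∧ c < 1 ∧ ∃ Γ' : Set (Rd d), IsOpenCone Γ' ∧ ξ₀ ∈ Γ' ∧
      ∀ ξ ∈ Γ', ∀ ζ, ‖ξ - ζ‖ ≤ c * ‖ξ‖ → ζ ∈ Γ := by
  have hne : ξ₀ ≠ 0 := fun h => hΓ.2.1 (h ▸ hξ₀)
  have hn : 0 < ‖ξ₀‖ := norm_pos_iff.mpr hne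
  obtain ⟨r, hr, hrΓ⟩ := Metric.isOpen_iff.mp hΓ.1 ξ₀ hξ₀
  -- After rescaling `ξ` to norm `‖ξ₀‖`, the distance of `ξ` from the axis and that of `ζ` from `ξ`
  -- add up to less than `2 * c * ‖ξ₀‖ ≤ r`. The strict inequality defining `Γ'` excludes the
  -- origin.
  set c := min (r / (2 * ‖ξ₀‖)) (1 / 2) with hc
  have hc0 : 0 < c := by positivity
  refine ⟨c, hc0, (min_le_right _ _).trans_lt (by norm_num),
    {ξ | ‖ξ - (‖ξ‖ / ‖ξ₀‖) • ξ₀‖ < c * ‖ξ‖}, ⟨?_, ?_, ?_⟩, ?_, ?_⟩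
  · exact isOpen_lt (by fun_prop) (by fun_prop)
  · simp
  · intro ξ hξ t ht
    simp only [Set.mem_ofPred_eq] at hξ ⊢
    have h1 : t • ξ - (‖t • ξ‖ / ‖ξ₀‖) • ξ₀ = t • (ξ - (‖ξ‖ / ‖ξ₀‖) • ξ₀) := by
      rw [norm_smul, Real.norm_of_nonneg ht.le, smul_sub, smul_smul, mul_div_assoc]
    rw [h1, norm_smul, norm_smul, Real.norm_of_nonneg ht.le]
    nlinarith
  · simp only [Set.mem_ofPred_eq, div_self hn.ne', one_smul, sub_self, norm_zero]
    positivity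
  · intro ξ hξ ζ hζ
    simp only [Set.mem_ofPred_eq] at hξ
    have hξ0 : 0 < ‖ξ‖ := by
      by_contra h
      have h0 : ‖ξ‖ = 0 := le_antisymm (not_lt.mp h) (norm_nonneg _)
      rw [h0, mul_zero] at hξ
      exact absurd hξ (not_lt.mpr (norm_nonneg _))
    set t := ‖ξ₀‖ / ‖ξ‖ with ht
    have ht0 : 0 < t := by positivity
    have hmem : t • ζ ∈ Γ := by
      refine hrΓ (mem_ball_iff_norm.mpr ?_)
      have h1 : t • ζ - ξ₀ = t • ((ξ - (‖ξ‖ / ‖ξ₀‖) • ξ₀) - (ξ - ζ)) := by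
        have : t * (‖ξ‖ / ‖ξ₀‖) = 1 := by
          rw [ht]
          field_simp
        rw [smul_sub, smul_sub, smul_smul, this, smul_sub, one_smul]
        abel
      have h2 : ‖(ξ - (‖ξ‖ / ‖ξ₀‖) • ξ₀) - (ξ - ζ)‖ < 2 * c * ‖ξ‖ := by
        have := norm_sub_le (ξ - (‖ξ‖ / ‖ξ₀‖) • ξ₀) (ξ - ζ)
        linarith
      rw [h1, norm_smul, Real.norm_of_nonneg ht0.le]
      calc t * _ < t * (2 * c * ‖ξ‖) := mul_lt_mul_of_pos_left h2 ht0
        _ = 2 * c * ‖ξ₀‖ := by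
          rw [ht]
          field_simp
        _ ≤ 2 * (r / (2 * ‖ξ₀‖)) * ‖ξ₀‖ := by
          have := min_le_left (r / (2 * ‖ξ₀‖)) (1 / 2)
          gcongr
        _ = r := by field_simp
    have := hΓ.2.2 _ hmem t⁻¹ (inv_pos.mpr ht0)
    rwa [smul_smul, inv_mul_cancel₀ ht0.ne', one_smul] at this

theorem fourier_mul_expFun {d : ℕ} (ψ : Rd d → ℂ) (ξ w : Rd d) :
    𝓕 (ψ * expFun ξ) w = 𝓕 ψ (w + (2 * Real.pi)⁻¹ • ξ) := by
  rw [Real.fourier_eq', Real.fourier_eq']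
  congr 1
  funext v
  simp only [smul_eq_mul, Pi.mul_apply, expFun, inner_add_right, inner_smul_right]
  rw [mul_left_comm, ← Complex.exp_add, mul_comm]
  congr 2
  push_cast
  have : (Real.pi : ℂ) ≠ 0 := by exact_mod_cast Real.pi_ne_zero
  field_simp
  ring

/-- The convolution formula for the Fourier transform of a product, in terms of values on
exponentials. -/
theorem CompactUltradistribution.apply_mul_expFun {d : ℕ} {s : ℝ} (hs : 1 < s)
    (u : CompactUltradistribution d s) {X : Set (Rd d)} {ψ : Rd d → ℂ} (hψ : ψ ∈ DBeurling s X)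
    (ξ : Rd d) :
    u.toLinearMap ⟨ψ * expFun ξ, mul_mem_EBeurling hs hψ.1 (expFun_mem hs ξ)⟩ =
      ∫ w, 𝓕 ψ ((2 * Real.pi)⁻¹ • ξ - w) *
        u.toLinearMap ⟨expFun ((2 * Real.pi) • w), expFun_mem hs _⟩ := by
  have hG := mul_mem_DBeurling hs hψ (expFun_mem hs ξ)
  set G : SchwartzMap (Rd d) ℂ := hG.2.1.toSchwartzMap hG.1.1 with hGdef
  have hGcoe : (G : Rd d → ℂ) = ψ * expFun ξ := rfl
  -- Fourier inversion writes `ψ * expFun ξ` as a superposition of exponentials with density `h`, to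
  -- which the functional applies under the integral.
  set h : SchwartzMap (Rd d) ℂ := 𝓕⁻ G with hh
  have hval : ∀ w, h w = 𝓕 ψ ((2 * Real.pi)⁻¹ • ξ - w) := by
    intro w
    rw [hh, SchwartzMap.fourierInv_coe, Real.fourierInv_eq_fourier_neg, hGcoe, fourier_mul_expFun,
      neg_add_eq_sub]
  have hfour : (ψ * expFun ξ) = 𝓕 (h : Rd d → ℂ) := by
    rw [← SchwartzMap.fourier_coe, hh, fourier_fourierInv_eq, hGcoe]
  have hint : ∀ r : ℝ, Integrable fun w : Rd d => ‖h w‖ * Real.exp (r * ‖w‖ ^ (1 / s)) := by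
    intro r
    obtain ⟨C, hC0, hC⟩ := exists_norm_fourier_le hs hG (N := |r| + 1) (by positivity)
    have hcont : Continuous fun w : Rd d => ‖h w‖ * Real.exp (r * ‖w‖ ^ (1 / s)) := by
      refine h.continuous.norm.mul ?_
      have := continuous_exp_neg_norm_rpow (d := d) (show 0 < s by linarith) (-r)
      simpa only [neg_mul, neg_neg] using this
    refine ((integrable_exp_neg_norm_rpow (d := d) hs.le one_pos).const_mul C).mono'
      hcont.aestronglyMeasurable (Eventually.of_forall fun w => ?_)
    have h1 : ‖h w‖ ≤ C * Real.exp (-((|r| + 1) * ‖w‖ ^ (1 / s))) := by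
      have := hC (-w)
      rwa [norm_neg, fourier_mul_expFun, neg_add_eq_sub, ← hval] at this
    rw [Real.norm_of_nonneg (by positivity)]
    calc _ ≤ C * Real.exp (-((|r| + 1) * ‖w‖ ^ (1 / s))) * Real.exp (r * ‖w‖ ^ (1 / s)) :=
          mul_le_mul_of_nonneg_right h1 (Real.exp_pos _).le
      _ ≤ _ := by
          rw [mul_assoc, ← Real.exp_add]
          refine mul_le_mul_of_nonneg_left (Real.exp_le_exp.mpr ?_) hC0
          have : 0 ≤ ‖w‖ ^ (1 / s) := by positivity
          nlinarith [le_abs_self r]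
  rw [u.apply_fourier hs h hint _ hfour]
  simp only [hval]

/-- Multiplication by `ψ ∈ 𝒟^{(s)}` preserves stretched exponential decay in an open cone, up to
shrinking the cone; the decay hypothesis is only needed in the mean. -/
theorem CompactUltradistribution.exists_cone_decay_mul {d : ℕ} {s : ℝ} (hs : 1 < s)
    (u : CompactUltradistribution d s) {X : Set (Rd d)} {ψ : Rd d → ℂ} (hψ : ψ ∈ DBeurling s X)
    {Γ : Set (Rd d)} (hΓ : IsOpenCone Γ) {ξ₀ : Rd d} (hξ₀ : ξ₀ ∈ Γ) {k : ℝ} (hk : 0 < k)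
    (hint : IntegrableOn (fun ξ : Rd d => ‖u.toLinearMap ⟨expFun ξ, expFun_mem hs ξ⟩‖ *
      Real.exp (k * ‖ξ‖ ^ (1 / s))) Γ) :
    ∃ Γ' : Set (Rd d), IsOpenCone Γ' ∧ ξ₀ ∈ Γ' ∧ ∃ k' : ℝ, 0 < k' ∧ ∃ C : ℝ, 0 < C ∧ ∀ ξ ∈ Γ',
      ‖u.toLinearMap ⟨ψ * expFun ξ, mul_mem_EBeurling hs hψ.1 (expFun_mem hs ξ)⟩‖ ≤
        C * Real.exp (-k' * ‖ξ‖ ^ (1 / s)) := by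
  have hs0 : 0 < s := by linarith
  have hσ : 0 ≤ 1 / s := by positivity
  have h2π : 0 < 2 * Real.pi := by positivity
  obtain ⟨c, hc0, hc1, Γ', hΓ', hξΓ', hsub⟩ := hΓ.exists_subcone hξ₀
  set U : Rd d → ℂ := fun ξ => u.toLinearMap ⟨expFun ξ, expFun_mem hs ξ⟩ with hU
  obtain ⟨D, r, hD0, hr0, hD⟩ := u.exists_norm_apply_expFun_le hs
  -- Away from `ξ`, `‖ζ‖ ≤ (1 + 1/c) ‖ξ - ζ‖`, so the first summand cancels the growth of `u`. Of
  -- the remaining `2`, one unit gives decay in `ξ` and the other integrability in `w`.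
  set N := r * (1 + 1 / c) ^ (1 / s) + 2 with hN
  have hN2 : 2 ≤ N := by
    have : 0 ≤ r * (1 + 1 / c) ^ (1 / s) := by positivity
    linarith
  obtain ⟨M, hM0, hM⟩ := exists_norm_fourier_le hs hψ (N := N * (2 * Real.pi) ^ (1 / s))
    (by positivity)
  have hM' : ∀ ξ w : Rd d, ‖𝓕 ψ ((2 * Real.pi)⁻¹ • ξ - w)‖ ≤
      M * Real.exp (-(N * ‖ξ - (2 * Real.pi) • w‖ ^ (1 / s))) := by
    intro ξ w
    refine (hM _).trans (le_of_eq ?_)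
    have h1 : ξ - (2 * Real.pi) • w = (2 * Real.pi) • ((2 * Real.pi)⁻¹ • ξ - w) := by
      rw [smul_sub, smul_smul, mul_inv_cancel₀ h2π.ne', one_smul]
    rw [h1, norm_smul, Real.norm_of_nonneg h2π.le, Real.mul_rpow h2π.le (norm_nonneg _), mul_assoc]
  set F : Rd d → ℝ := Γ.indicator fun ξ => ‖U ξ‖ * Real.exp (k * ‖ξ‖ ^ (1 / s)) with hF
  have hF0 : ∀ ζ, 0 ≤ F ζ := fun ζ => Set.indicator_nonneg (fun _ _ => by positivity) ζ
  have hFint : Integrable fun w => F ((2 * Real.pi) • w) :=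
    ((integrable_indicator_iff hΓ.1.measurableSet).mpr hint).comp_smul h2π.ne'
  set g : Rd d → ℝ := fun y => Real.exp (-(1 * ‖(2 * Real.pi) • y‖ ^ (1 / s))) with hg
  have hgint : Integrable g := (integrable_exp_neg_norm_rpow (d := d) hs.le one_pos).comp_smul h2π.ne'
  set α := k * (1 - c) ^ (1 / s) with hα
  set β := c ^ (1 / s) with hβ
  have hα0 : 0 < α := mul_pos hk (Real.rpow_pos_of_pos (by linarith) _)
  have hβ0 : 0 < β := Real.rpow_pos_of_pos hc0 _
  have hpt : ∀ ξ ∈ Γ', ∀ w, ‖𝓕 ψ ((2 * Real.pi)⁻¹ • ξ - w) * U ((2 * Real.pi) • w)‖ ≤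
      M * Real.exp (-(α * ‖ξ‖ ^ (1 / s))) * F ((2 * Real.pi) • w) +
        M * D * Real.exp (-(β * ‖ξ‖ ^ (1 / s))) * g ((2 * Real.pi)⁻¹ • ξ - w) := by
    intro ξ hξ w
    have hgval : g ((2 * Real.pi)⁻¹ • ξ - w) =
        Real.exp (-(‖ξ - (2 * Real.pi) • w‖ ^ (1 / s))) := by
      simp only [hg]
      rw [smul_sub, smul_smul, mul_inv_cancel₀ h2π.ne', one_smul, one_mul]
    rw [hgval, norm_mul]
    set ζ := (2 * Real.pi) • w with hζ
    have hMw := hM' ξ w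
    rw [← hζ] at hMw
    -- Near `ξ` the frequency `ζ` lies in `Γ` with `‖ζ‖ ≥ (1 - c) ‖ξ‖`, so part of the integrable
    -- weight becomes decay in `ξ`; elsewhere `‖ξ - ζ‖` dominates both `‖ξ‖` and `‖ζ‖`.
    by_cases hnear : ‖ξ - ζ‖ ≤ c * ‖ξ‖
    · have hζΓ := hsub ξ hξ ζ hnear
      have hFζ : F ζ = ‖U ζ‖ * Real.exp (k * ‖ζ‖ ^ (1 / s)) := Set.indicator_of_mem hζΓ _
      have h1 : (1 - c) * ‖ξ‖ ≤ ‖ζ‖ := by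
        have := norm_sub_norm_le ξ ζ
        linarith
      have h2 : α * ‖ξ‖ ^ (1 / s) ≤ k * ‖ζ‖ ^ (1 / s) := by
        rw [hα, mul_assoc, ← Real.mul_rpow (by linarith) (norm_nonneg _)]
        exact mul_le_mul_of_nonneg_left (Real.rpow_le_rpow
          (mul_nonneg (by linarith) (norm_nonneg _)) h1 hσ) hk.le
      have h3 : ‖U ζ‖ ≤ Real.exp (-(α * ‖ξ‖ ^ (1 / s))) * F ζ := by
        rw [hFζ, mul_left_comm, ← Real.exp_add]
        exact le_mul_of_one_le_right (norm_nonneg _) (Real.one_le_exp (by linarith))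
      have h4 : ‖𝓕 ψ ((2 * Real.pi)⁻¹ • ξ - w)‖ ≤ M := by
        refine hMw.trans (mul_le_of_le_one_right hM0 (Real.exp_le_one_iff.mpr ?_))
        have : 0 ≤ N * ‖ξ - ζ‖ ^ (1 / s) := by positivity
        linarith
      have h5 := mul_le_mul h4 h3 (norm_nonneg _) hM0
      have h6 : 0 ≤ M * D * Real.exp (-(β * ‖ξ‖ ^ (1 / s))) *
        Real.exp (-(‖ξ - ζ‖ ^ (1 / s))) := by positivity
      linarith
    · have hfar : c * ‖ξ‖ ≤ ‖ξ - ζ‖ := (not_le.mp hnear).le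
      have h1 : ‖ζ‖ ≤ (1 + 1 / c) * ‖ξ - ζ‖ := by
        have h2 : ‖ξ‖ ≤ 1 / c * ‖ξ - ζ‖ := by
          rw [one_div, ← div_eq_inv_mul, le_div_iff₀ hc0]
          linarith
        have h3 : ‖ζ‖ ≤ ‖ξ‖ + ‖ξ - ζ‖ := by
          have := norm_sub_norm_le ζ ξ
          rw [norm_sub_rev] at this
          linarith
        linarith
      have h2 : r * ‖ζ‖ ^ (1 / s) ≤ r * (1 + 1 / c) ^ (1 / s) * ‖ξ - ζ‖ ^ (1 / s) := by
        rw [mul_assoc, ← Real.mul_rpow (by positivity) (norm_nonneg _)]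
        exact mul_le_mul_of_nonneg_left (Real.rpow_le_rpow (norm_nonneg _) h1 hσ) hr0
      have h3 : β * ‖ξ‖ ^ (1 / s) ≤ ‖ξ - ζ‖ ^ (1 / s) := by
        rw [hβ, ← Real.mul_rpow hc0.le (norm_nonneg _)]
        exact Real.rpow_le_rpow (by positivity) hfar hσ
      have h4 := mul_le_mul hMw (hD ζ) (norm_nonneg _) (by positivity)
      have h5 : Real.exp (-(N * ‖ξ - ζ‖ ^ (1 / s))) * Real.exp (r * ‖ζ‖ ^ (1 / s)) ≤
          Real.exp (-(β * ‖ξ‖ ^ (1 / s))) * Real.exp (-(‖ξ - ζ‖ ^ (1 / s))) := by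
        rw [← Real.exp_add, ← Real.exp_add]
        refine Real.exp_le_exp.mpr ?_
        rw [hN]
        linarith
      have h6 := mul_le_mul_of_nonneg_left h5 (mul_nonneg hM0 hD0)
      have h7 : 0 ≤ M * Real.exp (-(α * ‖ξ‖ ^ (1 / s))) * F ζ := by
        have := hF0 ζ
        positivity
      calc ‖𝓕 ψ ((2 * Real.pi)⁻¹ • ξ - w)‖ * ‖U ζ‖ ≤ _ := h4
        _ = M * D * (Real.exp (-(N * ‖ξ - ζ‖ ^ (1 / s))) * Real.exp (r * ‖ζ‖ ^ (1 / s))) := by ring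
        _ ≤ _ := h6
        _ ≤ _ := by linarith
  set I := ∫ w, F ((2 * Real.pi) • w) with hI
  have hI0 : 0 ≤ I := integral_nonneg fun w => hF0 _
  set E := ∫ y, g y with hE
  have hE0 : 0 ≤ E := integral_nonneg fun y => (Real.exp_pos _).le
  refine ⟨Γ', hΓ', hξΓ', min α β, lt_min hα0 hβ0, M * I + M * D * E + 1, by positivity, fun ξ hξ => ?_⟩
  rw [u.apply_mul_expFun hs hψ ξ]
  have hbound := norm_integral_le_of_norm_le (μ := volume)
    ((hFint.const_mul (M * Real.exp (-(α * ‖ξ‖ ^ (1 / s))))).add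
      ((hgint.comp_sub_left ((2 * Real.pi)⁻¹ • ξ)).const_mul
        (M * D * Real.exp (-(β * ‖ξ‖ ^ (1 / s))))))
    (Eventually.of_forall (hpt ξ hξ))
  refine hbound.trans ?_
  simp only [Pi.add_apply]
  rw [integral_add (hFint.const_mul _) ((hgint.comp_sub_left _).const_mul _), integral_const_mul,
    integral_const_mul, integral_sub_left_eq_self g volume]
  have hx : 0 ≤ ‖ξ‖ ^ (1 / s) := by positivity
  have h1 : Real.exp (-(α * ‖ξ‖ ^ (1 / s))) ≤ Real.exp (-(min α β) * ‖ξ‖ ^ (1 / s)) := by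
    refine Real.exp_le_exp.mpr ?_
    rw [neg_mul]
    exact neg_le_neg (mul_le_mul_of_nonneg_right (min_le_left _ _) hx)
  have h2 : Real.exp (-(β * ‖ξ‖ ^ (1 / s))) ≤ Real.exp (-(min α β) * ‖ξ‖ ^ (1 / s)) := by
    refine Real.exp_le_exp.mpr ?_
    rw [neg_mul]
    exact neg_le_neg (mul_le_mul_of_nonneg_right (min_le_right _ _) hx)
  have h3 := mul_le_mul_of_nonneg_left h1 (mul_nonneg hM0 hI0)
  have h4 := mul_le_mul_of_nonneg_left h2 (mul_nonneg (mul_nonneg hM0 hD0) hE0)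
  have h5 := Real.exp_pos (-(min α β) * ‖ξ‖ ^ (1 / s))
  calc _ = M * I * Real.exp (-(α * ‖ξ‖ ^ (1 / s))) +
        M * D * E * Real.exp (-(β * ‖ξ‖ ^ (1 / s))) := by ring
    _ ≤ _ := by linarith

/-! ### Weighted seminorms and comparison of the wave-front sets -/

theorem norm_fourier_eq {d : ℕ} {s : ℝ} (hs : 1 < s) (u : CompactUltradistribution d s) (ξ : Rd d) :
    ‖fourier hs u ξ‖ = (2 * Real.pi) ^ (-(d : ℝ) / 2) * ‖u.toLinearMap ⟨expFun ξ, expFun_mem hs ξ⟩‖ := by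
  rw [fourier, norm_mul, Complex.norm_real, Real.norm_of_nonneg (by positivity)]

theorem continuous_fourier {d : ℕ} {s : ℝ} (hs : 1 < s) (u : CompactUltradistribution d s) :
    Continuous (fourier hs u) :=
  continuous_const.mul (u.continuous_apply_expFun hs)

theorem continuous_expWeight {d : ℕ} {s : ℝ} (hs : 0 < s) (k : ℝ) :
    Continuous (expWeight s k : Rd d → ℝ) := by
  have := continuous_exp_neg_norm_rpow (d := d) hs (-k)
  simp only [neg_mul, neg_neg] at this
  exact this

/-- Hölder: a smaller exponential weight allows one to pass from `L^q` to `L^1`. -/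
theorem integrableOn_of_coneSeminorm_lt_top {d : ℕ} {s : ℝ} (hs : 1 < s) {q : ℝ≥0∞} (hq : 1 ≤ q)
    {k : ℝ} (hk : 0 < k) {Γ : Set (Rd d)} (u : CompactUltradistribution d s)
    (h : coneSeminorm hs q (expWeight s k) Γ u < ⊤) :
    IntegrableOn (fun ξ : Rd d => ‖u.toLinearMap ⟨expFun ξ, expFun_mem hs ξ⟩‖ *
      Real.exp (k / 2 * ‖ξ‖ ^ (1 / s))) Γ := by
  have hs0 : 0 < s := by linarith
  have : ENNReal.HolderConjugate q q.conjExponent := .conjExponent hq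
  have : ENNReal.HolderConjugate q.conjExponent q := .symm
  have h1 : MemLp (fun ξ => fourier hs u ξ * (expWeight s k ξ : ℂ)) q (volume.restrict Γ) :=
    ⟨((continuous_fourier hs u).mul (Complex.continuous_ofReal.comp
      (continuous_expWeight hs0 k))).aestronglyMeasurable, h⟩
  have h2 : MemLp (fun ξ : Rd d => ((Real.exp (-(k / 2 * ‖ξ‖ ^ (1 / s))) : ℝ) : ℂ)) q.conjExponent
      (volume.restrict Γ) :=
    ((memLp_exp_neg_norm_rpow hs.le (half_pos hk)
      (ENNReal.HolderConjugate.ne_zero q.conjExponent q)).restrict Γ).ofReal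
  have h3 := (memLp_one_iff_integrable.mp (h1.mul h2 (r := 1))).norm
  set c : ℝ := (2 * Real.pi) ^ (-(d : ℝ) / 2) with hc
  have hc0 : 0 < c := by positivity
  refine (h3.const_mul c⁻¹).congr (Eventually.of_forall fun ξ => ?_)
  simp only [Pi.mul_apply, norm_mul, Complex.norm_real, Real.norm_of_nonneg (Real.exp_pos _).le,
    norm_fourier_eq, expWeight]
  rw [← hc]
  have h4 : Real.exp (k * ‖ξ‖ ^ (1 / s)) * Real.exp (-(k / 2 * ‖ξ‖ ^ (1 / s))) =
      Real.exp (k / 2 * ‖ξ‖ ^ (1 / s)) := by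
    rw [← Real.exp_add]
    congr 1
    ring
  rw [← h4]
  field_simp

/-- Half of the decay rate is spent on the weight; the other half leaves a stretched exponential
that lies in `L^q`. -/
theorem coneSeminorm_lt_top_of_le {d : ℕ} {s : ℝ} (hs : 1 < s) {q : ℝ≥0∞} (hq : q ≠ 0)
    {k : ℝ} (hk : 0 < k) {Γ : Set (Rd d)} (hΓ : IsOpenCone Γ) (u : CompactUltradistribution d s)
    {C : ℝ} (h : ∀ ξ ∈ Γ, ‖fourier hs u ξ‖ ≤ C * Real.exp (-k * ‖ξ‖ ^ (1 / s))) :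
    coneSeminorm hs q (expWeight s (k / 2)) Γ u < ⊤ := by
  have hmem := ((memLp_exp_neg_norm_rpow (d := d) hs.le (half_pos hk) hq).const_mul C).restrict Γ
  refine (eLpNorm_mono_ae_real ?_).trans_lt hmem.2
  filter_upwards [ae_restrict_mem hΓ.1.measurableSet] with ξ hξ
  rw [norm_mul, Complex.norm_real, expWeight, Real.norm_of_nonneg (Real.exp_pos _).le]
  refine (mul_le_mul_of_nonneg_right (h ξ hξ) (Real.exp_pos _).le).trans (le_of_eq ?_)
  rw [mul_assoc, ← Real.exp_add]
  congr 2
  ring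

/-- Finiteness of a weighted cone seminorm of a localization by a cut-off which does not vanish at
`x₀` implies micro-regularity. -/
theorem microRegular_of_mem_Theta {d : ℕ} {s : ℝ} (hs : 1 < s) {q : ℝ≥0∞} (hq : 1 ≤ q)
    {X : Set (Rd d)} (hX : IsOpen X) (f : Ultradistribution d s) {x₀ ξ₀ : Rd d} (hx₀ : x₀ ∈ X)
    (φ : DBeurling s X) (hφ : (φ : Rd d → ℂ) x₀ ≠ 0) {k : ℝ} (hk : 0 < k)
    (h : ξ₀ ∈ Theta hs q (expWeight s k) (f.localize hs φ)) : MicroRegular hs X f x₀ ξ₀ := by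
  obtain ⟨-, Γ, hΓ, hξ₀, hfin⟩ := h
  -- Supporting `χ` where `φ ≠ 0` makes `ψ = χ/φ` a test function with `φ ψ = χ`, so that `χ f` is
  -- `ψ` times `φ f`.
  have hU : IsOpen (X ∩ {x | (φ : Rd d → ℂ) x ≠ 0}) :=
    hX.inter (isOpen_ne_fun φ.2.1.1.continuous continuous_const)
  obtain ⟨χ, hχ, hχ1⟩ := exists_cutoff hs hU (x₀ := x₀) ⟨hx₀, hφ⟩
  have hne : ∀ x ∈ tsupport χ, (φ : Rd d → ℂ) x ≠ 0 := fun x hx => (hχ.2.2 hx).2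
  have hψ := mul_inv_mem_DBeurling hs hχ φ.2.1 hne
  set ψ : Rd d → ℂ := χ * (φ : Rd d → ℂ)⁻¹ with hψdef
  have hprod : (φ : Rd d → ℂ) * ψ = χ := by
    funext x
    by_cases hx : x ∈ tsupport χ
    · have := hne x hx
      simp only [hψdef, Pi.mul_apply, Pi.inv_apply]
      field_simp
    · simp [hψdef, image_eq_zero_of_notMem_tsupport hx]
  obtain ⟨Γ', hΓ', hξ₀', k', hk', C, hC, hbd⟩ :=
    (f.localize hs φ).exists_cone_decay_mul hs hψ hΓ hξ₀ (half_pos hk)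
      (integrableOn_of_coneSeminorm_lt_top hs hq hk _ hfin)
  have hc0 : 0 < (2 * Real.pi) ^ (-(d : ℝ) / 2) := by positivity
  refine ⟨⟨χ, hχ.1, hχ.2.1, fun x hx => (hχ.2.2 hx).1⟩, hχ1, Γ', hΓ', hξ₀', k', hk',
    (2 * Real.pi) ^ (-(d : ℝ) / 2) * C, mul_pos hc0 hC, fun ξ hξ => ?_⟩
  rw [norm_fourier_eq, mul_assoc]
  refine mul_le_mul_of_nonneg_left (le_trans (le_of_eq ?_) (hbd ξ hξ)) hc0.le
  congr 1
  simp only [Ultradistribution.localize, LinearMap.coe_mk, AddHom.coe_mk]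
  congr 2
  rw [← hprod, mul_assoc]

end UltraWF

end

theorem proposition3p2 (d : ℕ) (s : ℝ) (hs : 1 < s) (q : ℝ≥0∞) (hq : 1 ≤ q)
    (X : Set (UltraWF.Rd d)) (hX : IsOpen X) (f : UltraWF.Ultradistribution d s) :
    (⋂ k ∈ Set.Ioi (0 : ℝ), UltraWF.WFFourierLebesgue hs X q (UltraWF.expWeight s k) f) =
      UltraWF.WFs hs X f := by
  ext ⟨x₀, ξ₀⟩
  simp only [Set.mem_iInter, Set.mem_Ioi]
  constructor
  · intro h
    -- Any positive weight parameter will do to read off `x₀ ∈ X` and `ξ₀ ≠ 0`.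
    obtain ⟨hx₀, hξ₀, -⟩ := h 1 one_pos
    refine ⟨hx₀, hξ₀, ?_⟩
    rintro ⟨φ, hφ, Γ, hΓ, hξΓ, k, hk, C, -, hbd⟩
    have hφ0 : (φ : UltraWF.Rd d → ℂ) x₀ ≠ 0 := by
      rw [hφ.self_of_nhds]
      exact one_ne_zero
    exact ((h (k / 2) (half_pos hk)).2.2 φ hφ0).2 ⟨hξ₀, Γ, hΓ, hξΓ,
      UltraWF.coneSeminorm_lt_top_of_le hs (zero_lt_one.trans_le hq).ne' hk hΓ _ hbd⟩
  · rintro ⟨hx₀, hξ₀, hnot⟩ k hk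
    exact ⟨hx₀, hξ₀, fun φ hφ => ⟨hξ₀, fun hmem =>
      hnot (UltraWF.microRegular_of_mem_Theta hs hq hX f hx₀ φ hφ hk hmem)⟩⟩
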